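/- A language is a set $L\subseteq\{0,1\}^*$. For $T:\mathbb N\to\mathbb R$, let $\mathsf{DTIME}[T(n)]$ be the class of languages decided by a deterministic (multitape) Turing machine that runs in time $O(T(n))$ on inputs of length $n$, and let $\mathsf{EEXP}=\bigcup_{p}\mathsf{DTIME}[2^{2^{p(n)}}]$, the union being over all polynomials $p$. For $s:\mathbb N\to\mathbb N$, let $\mathsf{DTIME}[T(n)]/s(n)$ be the class of languages $L$ for which there are a deterministic Turing machine $M$ and advice strings $\alpha_n\in\{0,1\}^*$ with $|\alpha_n|\le s(n)$ $(n\in\mathbb N)$ such that, for every $n$ and every $x\in\{0,1\}^n$, $M$ on input $(x,\alpha_n)$ halts within $O(T(n))$ steps and accepts if and only if $x\in L$. Then for all real constants $k\ge 1$, $c$ and $\varepsilon$ with $c+\varepsilon<1$, $$\mathsf{EEXP}\not\subseteq\mathsf{DTIME}\big[2^{kn^k}\big]\big/\,\varepsilon 2^{cn},$$ where the number of advice bits $\varepsilon 2^{cn}$ is read as $\max(0,\lfloor\varepsilon 2^{cn}\rfloor)$. -/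

import Mathlib

/-!
# Deterministic time classes with and without advice

The machine model is Mathlib's `Turing.FinTM2`: a deterministic machine with finitely many control
labels and internal states and a finite number of work stacks over finite alphabets.  A stack is a
one-sided tape and a two-way infinite tape is a pair of stacks, so this is the multitape Turing
machine, and the two step counts agree up to a constant factor.  `Turing.TM2ComputableAux Γ₀ Γ₁` is
such a machine with input alphabet `Γ₀` and output alphabet `Γ₁`.
-/

namespace TimeClasses

/-- `M`, started on the input word `w`, halts after at most `t` steps with the bit `b` as output. -/
def OutputsWithin {Γ₀ : Type} (M : Turing.TM2ComputableAux Γ₀ Bool) (w : List Γ₀) (b : Bool)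
    (t : ℝ) : Prop :=
  ∃ m : ℕ, (m : ℝ) ≤ t ∧
    Nonempty (Turing.TM2OutputsInTime M.tm (w.map M.inputAlphabet.invFun)
      (some ([b].map M.outputAlphabet.invFun)) m)

/-- `DTIME[T]`: the languages over `{0,1}` that some deterministic machine decides, on every input
of length `n`, in time `O(T n)`. -/
def DTIME (T : ℕ → ℝ) : Set (Language Bool) :=
  {L | ∃ M : Turing.TM2ComputableAux Bool Bool, ∃ C : ℝ, ∀ x : List Bool,
    ∃ b : Bool, (b = true ↔ x ∈ L) ∧ OutputsWithin M x b (C * T x.length)}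

/-- `EEXP`: doubly exponential time, the union over all polynomials `p` of `DTIME[2^(2^(p n))]`;
the polynomials `n ^ j` are cofinal. -/
def EEXP : Set (Language Bool) :=
  ⋃ j : ℕ, DTIME fun n => (2 : ℝ) ^ ((2 : ℕ) ^ (n ^ j))

/-- The pair of an input `x` and an advice string `a` as a single word over `{0, 1, #}`, where `#`
is `none`: the word `x # a`. -/
def withAdvice (x a : List Bool) : List (Option Bool) :=
  x.map some ++ none :: a.map some

/-- `DTIME[T] / s`: the languages `L` over `{0,1}` for which there are a deterministic machine and
one advice string `α n` of at most `s n` bits for every input length `n`, such that on every input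
`x` of length `n`, together with the advice `α n`, the machine decides whether `x ∈ L` in
time `O(T n)`. -/
def DTIMEWithAdvice (T : ℕ → ℝ) (s : ℕ → ℕ) : Set (Language Bool) :=
  {L | ∃ M : Turing.TM2ComputableAux (Option Bool) Bool, ∃ α : ℕ → List Bool, ∃ C : ℝ,
    (∀ n, (α n).length ≤ s n) ∧
    ∀ x : List Bool, ∃ b : Bool, (b = true ↔ x ∈ L) ∧
      OutputsWithin M (withAdvice x (α x.length)) b (C * T x.length)}

end TimeClasses

namespace TimeClasses

open Turing Function

/-! ### A structured language of stack programs -/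

/-! The proof is a diagonalisation by counting. At input length `n` there are `2^(2^n)` truth
tables. A machine together with `s` bits of advice is coded by one number `D < n^(s+4)`, once `n`
exceeds the constants attached to the machine. Since `c + ε < 1`, either `ε ≤ 0` and the advice is
empty, or `c < 1` and the advice has length `o(2^n / n)`. In both cases `n * (s + 4) ≤ 2^n` for
large `n`, so `D < 2^(2^n) - 1`. By pigeonhole (`exists_hard`) some table differs from what every
such `D` accepts within `2^(n^j)` simulated steps, and for suitable `j` this exceeds any `O(2^(k
n^k))`. The language `diagLanguage` takes the least such table at each length, so it depends on
neither machine nor advice.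

Membership in `EEXP` is exhaustive search over tables, descriptions and inputs. All quantities stay
below `V = 2^(2^(n^J))`, and time polynomial in `V` is allowed, so numbers can be kept in unary.
Structured programs are compiled to stack machines (`Cmd.iter_code`). Functions computable in time
polynomial in unary arguments are closed under composition and polynomially bounded primitive
recursion (`Cmd.PT.comp`, `Cmd.PT.natRec`), which gives `diagLanguage_mem_EEXP`.

The universal machine must therefore be plain arithmetic, for any number of stacks. A run is stored
as the sequence of its control states, read as a number in base `N`; stack tops are recovered by
scanning this history backwards, and the transition table sits in Gödel's beta function. A machine
thus becomes three constants `N, p, q`, and its advice an initial piece of history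
(`HistSim.exists_description`). Cutting values off at `V` keeps the recursions bounded and never
alters the runs that matter. -/

/-- Structured programs acting on stacks of bits indexed by `ℕ`. -/
inductive Cmd : Type
  | push (r : ℕ) (b : Bool)
  | pop (r : ℕ)
  | seq (c d : Cmd)
  | ite (r : ℕ) (c d : Cmd)
  | whl (r : ℕ) (c : Cmd)

namespace Cmd

/-- The contents of the stacks. -/
abbrev St := ℕ → List Bool

/-- `Exec c S S' t`: the program `c` takes `S` to `S'` in exactly `t` steps.  The conditional looks
whether the top of the stack is `true`, the loop whether the stack is nonempty. -/
inductive Exec : Cmd → St → St → ℕ → Prop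
  | push (r b S) : Exec (push r b) S (update S r (b :: S r)) 1
  | pop (r S) : Exec (pop r) S (update S r (S r).tail) 1
  | seq {c d S S' S'' t t'} : Exec c S S' t → Exec d S' S'' t' → Exec (seq c d) S S'' (t + t')
  | iteTrue {r c d S S' t} : (S r).head? = some true → Exec c S S' t →
      Exec (ite r c d) S S' (1 + t)
  | iteFalse {r c d S S' t} : (S r).head? ≠ some true → Exec d S S' t →
      Exec (ite r c d) S S' (1 + t)
  | whlDone {r c S} : S r = [] → Exec (whl r c) S S 1
  | whlStep {r c S S' S'' t t'} : S r ≠ [] → Exec c S S' t → Exec (whl r c) S' S'' t' →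
      Exec (whl r c) S S'' (1 + t + t')

/-- A strict upper bound for the stacks a program mentions. -/
def bound : Cmd → ℕ
  | push r _ => r + 1
  | pop r => r + 1
  | seq c d => max c.bound d.bound
  | ite r c d => max (r + 1) (max c.bound d.bound)
  | whl r c => max (r + 1) c.bound

/-- The labels of the compiled program. -/
def Lab : Cmd → Type
  | push _ _ => Unit
  | pop _ => Unit
  | seq c d => c.Lab ⊕ d.Lab
  | ite _ c d => Option (c.Lab ⊕ d.Lab)
  | whl _ c => Option c.Lab

/-- The label at which the compiled program starts. -/
def entry : (c : Cmd) → c.Lab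
  | push _ _ => ()
  | pop _ => ()
  | seq c _ => Sum.inl c.entry
  | ite _ _ _ => (none : Option _)
  | whl _ _ => (none : Option _)

/-- There are finitely many labels. -/
@[reducible] noncomputable def labFintype : (c : Cmd) → Fintype c.Lab
  | push _ _ => inferInstanceAs (Fintype Unit)
  | pop _ => inferInstanceAs (Fintype Unit)
  | seq c d => @instFintypeSum _ _ c.labFintype d.labFintype
  | ite _ c d => @instFintypeOption _ (@instFintypeSum _ _ c.labFintype d.labFintype)
  | whl _ c => @instFintypeOption _ c.labFintype

/-- Jump to a label, resetting the internal state. -/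
def jump {K Λ : Type} (l : Λ) : TM2.Stmt (fun _ : K => Bool) Λ (Option Bool) :=
  .load (fun _ => none) (.goto fun _ => l)

/-- The code of a program: `emb` places its labels in the machine, `ex` is the label to go to
afterwards. -/
def code {K Λ : Type} (φ : ℕ → K) :
    (c : Cmd) → (c.Lab → Λ) → Λ → c.Lab → TM2.Stmt (fun _ : K => Bool) Λ (Option Bool)
  | push r b, _, ex, _ => .push (φ r) (fun _ => b) (jump ex)
  | pop r, _, ex, _ => .pop (φ r) (fun v _ => v) (jump ex)
  | seq c d, emb, ex, l => Sum.casesOn (motive := fun _ => _) (l : c.Lab ⊕ d.Lab)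
      (code φ c (fun x => emb (Sum.inl x)) (emb (Sum.inr d.entry)))
      (code φ d (fun x => emb (Sum.inr x)) ex)
  | ite r c d, emb, ex, l => Option.casesOn (motive := fun _ => _) (l : Option (c.Lab ⊕ d.Lab))
      (.peek (φ r) (fun _ o => o) (.branch (fun v => v == some true)
        (jump (emb (some (Sum.inl c.entry)))) (jump (emb (some (Sum.inr d.entry))))))
      (fun s => Sum.casesOn (motive := fun _ => _) s
        (code φ c (fun x => emb (some (Sum.inl x))) ex)
        (code φ d (fun x => emb (some (Sum.inr x))) ex))
  | whl r c, emb, ex, l => Option.casesOn (motive := fun _ => _) (l : Option c.Lab)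
      (.peek (φ r) (fun _ o => o) (.branch (fun v => v.isSome)
        (jump (emb (some c.entry))) (jump ex)))
      (code φ c (fun x => emb (some x)) (emb (none : Option c.Lab)))

/-- The configuration of a compiled program at a label. -/
def cfg {R : ℕ} {Λ : Type} (l : Option Λ) (S : St) :
    TM2.Cfg (fun _ : Fin R => Bool) Λ (Option Bool) :=
  ⟨l, none, fun k => S k⟩

/-- Iterating a partial step function. -/
def iter {α : Type} (f : α → Option α) (n : ℕ) (a : Option α) : Option α := (flip bind f)^[n] a

theorem iter_add {α : Type} (f : α → Option α) {m n : ℕ} {a b c : Option α}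
    (h : iter f m a = b) (h' : iter f n b = c) : iter f (m + n) a = c := by
  unfold iter at *
  rw [add_comm, Function.iterate_add_apply, h, h']

theorem iter_one {α : Type} (f : α → Option α) (a : α) : iter f 1 (some a) = f a := rfl

theorem update_fin {R r : ℕ} (hr : r < R) (φ : ℕ → Fin R) (hφ : ∀ r, r < R → ((φ r : Fin R) : ℕ) = r)
    (S : St) (x : List Bool) :
    update (fun k : Fin R => S k) (φ r) x = fun k : Fin R => update S r x k := by
  funext k
  by_cases h : k = φ r
  · subst h; simp [hφ r hr]
  · have : (k : ℕ) ≠ r := fun h' => h (Fin.ext (by rw [hφ r hr, h']))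
    simp [h, this]

/-- Every statement produced by `code` ends in `jump`, which resets the internal state. Hence each
unit of `Exec` time is exactly one machine step between configurations of the form `cfg`. Keeping
the embedding of labels and the exit label arbitrary lets the induction place subprograms inside
larger ones. -/
theorem iter_code {R : ℕ} {Λ : Type} (φ : ℕ → Fin R) (hφ : ∀ r, r < R → ((φ r : Fin R) : ℕ) = r)
    (M : Λ → TM2.Stmt (fun _ : Fin R => Bool) Λ (Option Bool)) {c : Cmd} {S S' : St} {t : ℕ}
    (hE : Exec c S S' t) (hc : c.bound ≤ R) (emb : c.Lab → Λ) (ex : Λ)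
    (hM : ∀ l, M (emb l) = code φ c emb ex l) :
    iter (TM2.step M) t (some (cfg (some (emb c.entry)) S)) = some (cfg (some ex) S') := by
  induction hE generalizing ex with
  | push r b S =>
    rw [iter_one]
    have hr : r < R := hc
    simp [cfg, hM, code, jump, update_fin hr φ hφ, hφ r hr]
  | pop r S =>
    rw [iter_one]
    have hr : r < R := hc
    simp [cfg, hM, code, jump, update_fin hr φ hφ, hφ r hr]
  | @seq c d S S' S'' t t' h₁ h₂ ih₁ ih₂ =>
    exact iter_add _
      (ih₁ ((le_max_left _ _).trans hc) (fun x => emb (Sum.inl x)) _ fun l => hM (Sum.inl l))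
      (ih₂ ((le_max_right _ _).trans hc) (fun x => emb (Sum.inr x)) _ fun l => hM (Sum.inr l))
  | @iteTrue r c d S S' t h h₁ ih =>
    simp only [bound, max_le_iff] at hc
    have hr : r < R := hc.1
    refine iter_add _ ?_
      (ih hc.2.1 (fun x => emb (some (Sum.inl x))) ex fun l => hM (some (Sum.inl l)))
    rw [iter_one]
    have := hM none
    simp only [code] at this
    simp only [cfg, entry]
    rw [TM2.step, this]
    simp [jump, hφ r hr, h]
  | @iteFalse r c d S S' t h h₁ ih =>
    simp only [bound, max_le_iff] at hc
    have hr : r < R := hc.1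
    refine iter_add _ ?_
      (ih hc.2.2 (fun x => emb (some (Sum.inr x))) ex fun l => hM (some (Sum.inr l)))
    rw [iter_one]
    have := hM none
    simp only [code] at this
    simp only [cfg, entry]
    rw [TM2.step, this]
    have h' : ((S r).head? == some true) = false := by simpa using h
    simp [jump, hφ r hr, h']
  | @whlDone r c S h =>
    simp only [bound, max_le_iff] at hc
    have hr : r < R := hc.1
    rw [iter_one]
    have := hM none
    simp only [code] at this
    simp only [cfg, entry]
    rw [TM2.step, this]
    simp [jump, hφ r hr, h]
  | @whlStep r c S S' S'' t t' h h₁ h₂ ih₁ ih₂ =>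
    have hc' := hc
    simp only [bound, max_le_iff] at hc
    have hr : r < R := hc.1
    refine iter_add _ (iter_add _ ?_
      (ih₁ hc.2 (fun x => emb (some x)) _ fun l => hM (some l))) (ih₂ hc' emb ex hM)
    rw [iter_one]
    have := hM none
    simp only [code] at this
    simp only [cfg, entry]
    rw [TM2.step, this]
    have h' : (S r).head?.isSome = true := by
      cases h'' : S r with
      | nil => exact absurd h'' h
      | cons a l => rfl
    simp [jump, hφ r hr, h']

/-- The machine that runs a program, with stack `0` for input and output. -/
noncomputable def machine (c : Cmd) : FinTM2 :=
  haveI := c.labFintype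
  { K := Fin (c.bound + 1)
    k₀ := 0
    k₁ := 0
    Γ := fun _ => Bool
    Λ := Option c.Lab
    main := some c.entry
    σ := Option Bool
    initialState := none
    m := fun l => Option.casesOn (motive := fun _ => _) l .halt
      (code (fun r => Fin.ofNat _ r) c some none) }

/-- The machine of a program, with the identity encoding of bits. -/
noncomputable def aux (c : Cmd) : TM2ComputableAux Bool Bool where
  tm := c.machine
  inputAlphabet := Equiv.refl Bool
  outputAlphabet := Equiv.refl Bool

theorem dite_eq_update {R : ℕ} (x : List Bool) :
    (fun k : Fin (R + 1) => if _ : k = 0 then x else []) =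
      fun k : Fin (R + 1) => update (fun _ => []) 0 x (k : ℕ) := by
  funext k
  by_cases hk : k = 0
  · subst hk; simp
  · have hk' : (k : ℕ) ≠ 0 := fun h => hk (Fin.ext h)
    simp [hk, hk']

/-- The additional step executes `halt` at the label `none`. -/
theorem outputsWithin (c : Cmd) (x : List Bool) (b : Bool) {t : ℕ} {T : ℝ}
    (h : Exec c (update (fun _ => []) 0 x) (update (fun _ => []) 0 [b]) t) (hT : (t : ℝ) + 1 ≤ T) :
    OutputsWithin c.aux x b T := by
  refine ⟨t + 1, by exact_mod_cast hT, ⟨⟨⟨t + 1, ?_⟩, le_rfl⟩⟩⟩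
  have key := iter_code (R := c.bound + 1) (Λ := Option c.Lab) (fun r => Fin.ofNat _ r)
    (fun r hr => by simpa using Nat.mod_eq_of_lt hr) c.machine.m h (Nat.le_succ _) some none
    (fun l => rfl)
  have e₁ : initList c.machine (x.map c.aux.inputAlphabet.invFun) =
      cfg (R := c.bound + 1) (some (some c.entry)) (update (fun _ => []) 0 x) := by
    refine (congrArg (initList c.machine) (List.map_id x :)).trans ?_
    exact congrArg (TM2.Cfg.mk _ _) (dite_eq_update x)
  have e₂ : haltList c.machine ([b].map c.aux.outputAlphabet.invFun) =
      cfg (R := c.bound + 1) none (update (fun _ => []) 0 [b]) := by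
    refine (congrArg (haltList c.machine) (List.map_id [b] :)).trans ?_
    exact congrArg (TM2.Cfg.mk _ _) (dite_eq_update [b])
  have e₃ : iter c.machine.step (t + 1) (some (initList c.machine (x.map c.aux.inputAlphabet.invFun)))
      = some (haltList c.machine ([b].map c.aux.outputAlphabet.invFun)) := by
    rw [e₁, e₂]
    exact iter_add _ key rfl
  exact e₃

end Cmd

end TimeClasses

namespace TimeClasses

open Turing Function

namespace Cmd

/-! ### Running times and unary registers -/

/-- `c` takes `S` to `S'` in at most `T` steps. -/
def Runs (c : Cmd) (S S' : St) (T : ℕ) : Prop := ∃ t ≤ T, Exec c S S' t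

theorem Runs.mono {c : Cmd} {S S' : St} {T T' : ℕ} (h : Runs c S S' T) (hT : T ≤ T') :
    Runs c S S' T' :=
  h.imp fun _ ht => ⟨ht.1.trans hT, ht.2⟩

theorem Runs.seq {c d : Cmd} {S S' S'' : St} {T T' : ℕ} (h : Runs c S S' T)
    (h' : Runs d S' S'' T') : Runs (.seq c d) S S'' (T + T') := by
  obtain ⟨t, ht, e⟩ := h
  obtain ⟨t', ht', e'⟩ := h'
  exact ⟨t + t', add_le_add ht ht', e.seq e'⟩

theorem Runs.push (r : ℕ) (b : Bool) {S S' : St} (h : S' = update S r (b :: S r)) :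
    Runs (.push r b) S S' 1 :=
  ⟨1, le_rfl, h ▸ .push r b S⟩

theorem Runs.pop (r : ℕ) {S S' : St} (h : S' = update S r (S r).tail) :
    Runs (.pop r) S S' 1 :=
  ⟨1, le_rfl, h ▸ .pop r S⟩

theorem Runs.iteTrue {r : ℕ} {c d : Cmd} {S S' : St} {T : ℕ} (h : (S r).head? = some true)
    (h' : Runs c S S' T) : Runs (.ite r c d) S S' (1 + T) :=
  let ⟨t, ht, e⟩ := h'; ⟨1 + t, by lia, .iteTrue h e⟩

theorem Runs.iteFalse {r : ℕ} {c d : Cmd} {S S' : St} {T : ℕ} (h : (S r).head? ≠ some true)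
    (h' : Runs d S S' T) : Runs (.ite r c d) S S' (1 + T) :=
  let ⟨t, ht, e⟩ := h'; ⟨1 + t, by lia, .iteFalse h e⟩

theorem Runs.whl {r : ℕ} {c : Cmd} (σ : ℕ → St) (n τ : ℕ) (h₁ : ∀ i < n, σ i r ≠ [])
    (h₂ : ∀ i < n, Runs c (σ i) (σ (i + 1)) τ) (h₃ : σ n r = []) :
    Runs (.whl r c) (σ 0) (σ n) (n * (τ + 1) + 1) := by
  induction n generalizing σ with
  | zero => exact ⟨1, by lia, .whlDone h₃⟩
  | succ n ih =>
    obtain ⟨t, ht, e⟩ := h₂ 0 (Nat.succ_pos n)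
    obtain ⟨t', ht', e'⟩ := ih (fun i => σ (i + 1)) (fun i hi => h₁ _ (by lia))
      (fun i hi => h₂ _ (by lia)) h₃
    exact ⟨1 + t + t', by rw [Nat.succ_mul]; lia, .whlStep (h₁ 0 (Nat.succ_pos n)) e e'⟩

/-- The unary representation of a number. -/
abbrev rep (n : ℕ) : List Bool := List.replicate n true

theorem tail_rep (n : ℕ) : (rep n).tail = rep (n - 1) := by simp [rep]

/-- Empty a stack. -/
def clear (r : ℕ) : Cmd := .whl r (.pop r)

theorem runs_clear (r n : ℕ) {S S' : St} (h : S r = rep n) (hS : S' = update S r []) :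
    Runs (clear r) S S' (2 * n + 1) := by
  have := Runs.whl (r := r) (c := .pop r) (fun i => update S r (rep (n - i))) n 1
    (fun i hi => by simpa [Nat.sub_eq_zero_iff_le] using hi)
    (fun i hi => .pop _ (by
      simp only [update_self, update_idem]; rw [tail_rep, Nat.sub_sub]))
    (by simp)
  simp only [Nat.sub_zero, Nat.sub_self, ← h, update_eq_self] at this
  rw [hS]
  exact this.mono (by lia)

/-- Move the contents of a register on top of another one. -/
def move (a b : ℕ) : Cmd := .whl a (.seq (.pop a) (.push b true))

theorem runs_move {a b : ℕ} (n m : ℕ) (hab : a ≠ b) {S S' : St} (ha : S a = rep n) (hb : S b = rep m)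
    (hS : S' = update (update S a []) b (rep (m + n))) :
    Runs (move a b) S S' (3 * n + 1) := by
  have := Runs.whl (r := a) (c := .seq (.pop a) (.push b true))
    (fun i => update (update S a (rep (n - i))) b (rep (m + i))) n 2
    (fun i hi => by simpa [hab, Nat.sub_eq_zero_iff_le] using hi)
    (fun i hi => (Runs.pop (S' := update (update S a (rep (n - (i + 1)))) b (rep (m + i))) _ (by
        funext r
        simp only [update_apply, hab, if_true, if_false, tail_rep, Nat.sub_sub]
        split_ifs <;> simp_all)).seq (Runs.push _ _ (by
        funext r
        simp only [update_apply, if_true]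
        split_ifs <;> simp_all [List.replicate_succ, ← add_assoc])))
    (by simp [hab])
  have e : update (update S a (rep (n - 0))) b (rep (m + 0)) = S := by
    funext r; simp only [update_apply]; split_ifs <;> simp_all
  simp only [e, Nat.sub_self] at this
  rw [hS]
  exact this.mono (by lia)

/-- Copy a register to an empty one, using a third one that is empty. -/
def copy (a b z : ℕ) : Cmd :=
  .seq (.whl a (.seq (.pop a) (.seq (.push b true) (.push z true)))) (move z a)

theorem runs_copy {a b z : ℕ} (n : ℕ) (hab : a ≠ b) (haz : a ≠ z) (hbz : b ≠ z) {S S' : St}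
    (ha : S a = rep n) (hb : S b = []) (hz : S z = []) (hS : S' = update S b (rep n)) :
    Runs (copy a b z) S S' (7 * n + 2) := by
  have := Runs.whl (r := a) (c := .seq (.pop a) (.seq (.push b true) (.push z true)))
    (fun i => update (update (update S a (rep (n - i))) b (rep i)) z (rep i)) n 3
    (fun i hi => by simpa [hab, haz, Nat.sub_eq_zero_iff_le] using hi)
    (fun i hi => (Runs.pop
      (S' := update (update (update S a (rep (n - (i + 1)))) b (rep i)) z (rep i)) _ (by
        funext r
        simp only [update_apply, hab, haz, if_true, if_false, tail_rep, Nat.sub_sub]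
        split_ifs <;> simp_all)).seq ((Runs.push 
      (S' := update (update (update S a (rep (n - (i + 1)))) b (rep (i + 1))) z (rep i)) _ _ (by
        funext r
        simp only [update_apply, if_true]
        split_ifs <;> simp_all [List.replicate_succ])).seq (Runs.push _ _ (by
        funext r
        simp only [update_apply, if_true]
        split_ifs <;> simp_all [List.replicate_succ]))))
    (by simp [hab, haz])
  have e : update (update (update S a (rep (n - 0))) b (rep 0)) z (rep 0) = S := by
    funext r; simp only [update_apply]; split_ifs <;> simp_all
  simp only [e, Nat.sub_self] at this
  refine (this.seq (runs_move (S' := S') n 0 haz.symm (by simp) (by simp [hab, haz]) ?_)).mono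
    (by lia)
  subst hS
  funext r; simp only [update_apply]; split_ifs <;> simp_all

/-! ### Functions computed in a given time -/

/-- `f` can be computed in time `T`: for every choice of input registers `ρ`, of an output register
`o` and of a bound `m` for these, some program leaves the value of `f` in `o`, with no other effect,
provided that `o` and the registers from `m` on are empty. -/
def Computes {k : ℕ} (f T : (Fin k → ℕ) → ℕ) : Prop :=
  ∀ (ρ : Fin k → ℕ) (o m : ℕ), (∀ i, ρ i < m ∧ ρ i ≠ o) → o < m → ∃ c : Cmd, ∀ (S : St) v,
    (∀ i, S (ρ i) = rep (v i)) → S o = [] → (∀ r, m ≤ r → S r = []) →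
    Runs c S (update S o (rep (f v))) (T v)

variable {k : ℕ}

theorem Computes.mono {f T T' : (Fin k → ℕ) → ℕ} (h : Computes f T) (hT : ∀ v, T v ≤ T' v) :
    Computes f T' := fun ρ o m h₁ h₂ =>
  (h ρ o m h₁ h₂).imp fun _ hc S v h₃ h₄ h₅ => (hc S v h₃ h₄ h₅).mono (hT v)

theorem Computes.zero : Computes (fun _ : Fin k → ℕ => 0) (fun _ => 1) := fun ρ o m h₁ h₂ =>
  ⟨.pop o, fun _ _ _ h₄ _ => .pop _ (by simp [h₄])⟩

theorem Computes.proj (i : Fin k) : Computes (fun v => v i) (fun v => 7 * v i + 2) :=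
  fun ρ o m h₁ h₂ => ⟨copy (ρ i) o m, fun _ v h₃ h₄ h₅ =>
    runs_copy (v i) (h₁ i).2 (h₁ i).1.ne h₂.ne (h₃ i) h₄ (h₅ m le_rfl) rfl⟩

theorem Computes.succ {f T : (Fin k → ℕ) → ℕ} (h : Computes f T) :
    Computes (fun v => f v + 1) (fun v => T v + 1) := fun ρ o m h₁ h₂ =>
  let ⟨c, hc⟩ := h ρ o m h₁ h₂
  ⟨.seq c (.push o true), fun S v h₃ h₄ h₅ => (hc S v h₃ h₄ h₅).seq
    (.push _ _ (by simp [List.replicate_succ]))⟩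

theorem Computes.rename {l : ℕ} {f T : (Fin l → ℕ) → ℕ} (h : Computes f T) (e : Fin l → Fin k) :
    Computes (fun v => f fun i => v (e i)) (fun v => T fun i => v (e i)) := fun ρ o m h₁ h₂ =>
  let ⟨c, hc⟩ := h (fun i => ρ (e i)) o m (fun i => h₁ (e i)) h₂
  ⟨c, fun S _ h₃ h₄ h₅ => hc S _ (fun i => h₃ (e i)) h₄ h₅⟩

/-- The value of `g` is kept in the fresh register `m`, so the program for `F` gets the bound `m +
1`. Clearing `m` at the end restores the requirement of no other effect. -/
theorem Computes.bind {F TF : (Fin (k + 1) → ℕ) → ℕ} {g Tg : (Fin k → ℕ) → ℕ}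
    (hF : Computes F TF) (hg : Computes g Tg) :
    Computes (fun v => F (Matrix.vecCons (g v) v))
      (fun v => Tg v + (TF (Matrix.vecCons (g v) v) + (2 * g v + 1))) := by
  intro ρ o m h₁ h₂
  obtain ⟨c, hc⟩ := hg ρ m (m + 1) (fun i => ⟨(h₁ i).1.trans m.lt_succ_self, (h₁ i).1.ne⟩)
    m.lt_succ_self
  obtain ⟨d, hd⟩ := hF (Matrix.vecCons m ρ) o (m + 1)
    (fun i => by
      refine Fin.cases ?_ (fun i => ?_) i
      · exact ⟨m.lt_succ_self, h₂.ne'⟩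
      · exact ⟨(h₁ i).1.trans m.lt_succ_self, (h₁ i).2⟩)
    (h₂.trans m.lt_succ_self)
  refine ⟨.seq c (.seq d (clear m)), fun S v h₃ h₄ h₅ => ?_⟩
  refine (hc S v h₃ (h₅ m le_rfl) fun r hr => h₅ r (by lia)).seq
    ((hd _ (Matrix.vecCons (g v) v) (fun i => ?_) ?_ fun r hr => ?_).seq
      (runs_clear m (g v) ?_ ?_))
  · refine Fin.cases ?_ (fun i => ?_) i
    · simp
    · simp [(h₁ i).1.ne, h₃]
  · simp [h₂.ne, h₄]
  · simp [(show r ≠ m by lia), h₅ r (by lia)]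
  · simp [h₂.ne']
  · have := h₂.ne
    have := h₅ m le_rfl
    funext r
    simp only [update_apply]
    split_ifs <;> simp_all

/-- The values of a primitive recursion that starts with the first variable. -/
def recValue (g : (Fin (k + 4) → ℕ) → ℕ) (v : Fin (k + 2) → ℕ) (n : ℕ) : ℕ :=
  Nat.rec (v 0) (fun i a => g (Matrix.vecCons i (Matrix.vecCons a v))) n

theorem recValue_succ (g : (Fin (k + 4) → ℕ) → ℕ) (v : Fin (k + 2) → ℕ) (n : ℕ) :
    recValue g v (n + 1) = g (Matrix.vecCons n (Matrix.vecCons (recValue g v n) v)) := rfl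

theorem Computes.primrec {g Tg : (Fin (k + 4) → ℕ) → ℕ} (hg : Computes g Tg)
    (B τ : (Fin (k + 2) → ℕ) → ℕ) (hB : ∀ v, ∀ i ≤ v 1, recValue g v i ≤ B v)
    (hτ : ∀ v, ∀ i < v 1, Tg (Matrix.vecCons i (Matrix.vecCons (recValue g v i) v)) ≤ τ v) :
    Computes (fun v => recValue g v (v 1)) (fun v => (v 1 + 1) * (τ v + 10 * B v + 14)) := by
  intro ρ o m h₁ h₂
  obtain ⟨c, hc⟩ := hg (Matrix.vecCons (m + 2) (Matrix.vecCons (m + 1) ρ)) (m + 3) (m + 4)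
    (fun i => by
      refine Fin.cases ?_ (fun i => Fin.cases ?_ (fun i => ?_) i) i
      · simp
      · simp
      · have := (h₁ i).1
        simp only [Matrix.cons_val_succ]
        lia)
    (by lia)
  -- Register `m` counts the remaining rounds down, `m + 1` holds the accumulator, `m + 2` the index
  -- counting up, and `m + 3` receives the new value.
  refine ⟨.seq (copy (ρ 1) m (m + 1)) (.seq (copy (ρ 0) (m + 1) (m + 2))
    (.seq (.whl m (.seq (.pop m) (.seq c (.seq (clear (m + 1)) (.seq (move (m + 3) (m + 1))
      (.push (m + 2) true)))))) (.seq (move (m + 1) o) (clear (m + 2))))),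
    fun S v h₃ h₄ h₅ => ?_⟩
  have a0 := h₁ 0
  have a1 := h₁ 1
  have e0 := h₅ m (by lia)
  have e1 := h₅ (m + 1) (by lia)
  have e2 := h₅ (m + 2) (by lia)
  have e3 := h₅ (m + 3) (by lia)
  have B0 : v 0 ≤ B v := hB v 0 (Nat.zero_le _)
  have Bn := hB v (v 1) le_rfl
  set σ : ℕ → St := fun j =>
    update (update (update S m (rep (v 1 - j))) (m + 1) (rep (recValue g v j))) (m + 2) (rep j)
    with hσ
  have s1 : Runs (copy (ρ 1) m (m + 1)) S (update S m (rep (v 1))) (7 * v 1 + 2) :=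
    runs_copy (v 1) (by lia) (by lia) (by lia) (h₃ 1) e0 e1 rfl
  have s2 : Runs (copy (ρ 0) (m + 1) (m + 2)) (update S m (rep (v 1))) (σ 0) (7 * v 0 + 2) := by
    refine runs_copy (v 0) (by lia) (by lia) (by lia) ?_ ?_ ?_ ?_
    · simp [a0.1.ne, h₃]
    · simp [e1]
    · simp [e2]
    · funext r
      simp only [hσ, update_apply, Nat.sub_zero]
      split_ifs <;> simp_all [recValue]
  have s3 := Runs.whl (r := m) (c := (.seq (.pop m) (.seq c (.seq (clear (m + 1))
      (.seq (move (m + 3) (m + 1)) (.push (m + 2) true)))))) σ (v 1) (τ v + 5 * B v + 4)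
    (fun i hi => by simpa [hσ, Nat.sub_eq_zero_iff_le] using hi)
    (fun i hi => by
      set S1 := update (update (update S m (rep (v 1 - (i + 1)))) (m + 1) (rep (recValue g v i)))
        (m + 2) (rep i) with hS1
      have t1 : Runs (.pop m) (σ i) S1 1 := .pop _ (by
        funext r
        simp only [hσ, hS1, update_apply]
        split_ifs <;> first | lia | simp_all [Nat.sub_sub])
      have t2 : Runs c S1 (update S1 (m + 3) (rep (recValue g v (i + 1)))) (τ v) := by
        refine (hc S1 (Matrix.vecCons i (Matrix.vecCons (recValue g v i) v)) (fun j => ?_) ?_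
          fun r hr => ?_).mono (hτ v i hi)
        · refine Fin.cases ?_ (fun j => Fin.cases ?_ (fun j => ?_) j) j
          · simp [hS1]
          · simp [hS1]
          · have := (h₁ j).1
            simp [hS1, this.ne, h₃, (show ρ j ≠ m + 1 by lia), (show ρ j ≠ m + 2 by lia)]
        · simp [hS1, e3]
        · simp [hS1, (show r ≠ m by lia), (show r ≠ m + 1 by lia), (show r ≠ m + 2 by lia),
            h₅ r (by lia)]
      have Bi := hB v i hi.le
      have Bi' := hB v (i + 1) hi
      refine (t1.seq (t2.seq ((runs_clear (m + 1) (recValue g v i) (by simp [hS1]) rfl).seq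
        ((runs_move (recValue g v (i + 1)) 0 (by lia) (by simp) (by simp) rfl).seq
          (.push (m + 2) true ?_))))).mono (by lia)
      funext r
      simp only [hσ, hS1, update_apply]
      split_ifs <;> first | lia | simp_all [List.replicate_succ])
    (by simp [hσ])
  refine (s1.seq (s2.seq (s3.seq ((runs_move (recValue g v (v 1)) 0 (by lia) (by simp [hσ])
    (by simp [hσ, h₂.ne, (show o ≠ m + 1 by lia), (show o ≠ m + 2 by lia), h₄]) rfl).seq
    (runs_clear (m + 2) (v 1) (by simp [hσ, (show m + 2 ≠ o by lia)]) ?_))))).mono ?_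
  · funext r
    simp only [hσ, update_apply]
    split_ifs <;> first | lia | simp_all
  · have : (v 1 + 1) * (τ v + 10 * B v + 14) =
      v 1 * (τ v + 5 * B v + 4 + 1) + v 1 * (5 * B v) + 9 * v 1 + (τ v + 10 * B v + 14) := by ring
    lia

end Cmd

end TimeClasses

namespace TimeClasses

open Turing Function

namespace Cmd

variable {k : ℕ}

/-! ### Primitive recursion -/

theorem Computes.natRec {s n Ts Tn : (Fin k → ℕ) → ℕ} {g : ℕ → ℕ → (Fin k → ℕ) → ℕ}
    {T : (Fin (k + 2) → ℕ) → ℕ} (hs : Computes s Ts)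
    (hg : Computes (fun w : Fin (k + 2) → ℕ => g (w 0) (w 1) fun i => w i.succ.succ) T)
    (hn : Computes n Tn) (B τ : (Fin k → ℕ) → ℕ)
    (hB : ∀ v, ∀ i ≤ n v, Nat.rec (s v) (fun i a => g i a v) i ≤ B v)
    (hτ : ∀ v, ∀ i < n v, ∀ a ≤ B v, T (Matrix.vecCons i (Matrix.vecCons a v)) ≤ τ v) :
    Computes (fun v => Nat.rec (s v) (fun i a => g i a v) (n v))
      (fun v => Tn v + (Ts v + ((n v + 1) * (τ v + 10 * B v + 14) + (2 * s v + 1)) +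
        (2 * n v + 1))) := by
  let e : Fin (k + 2) → Fin (k + 4) :=
    Matrix.vecCons 0 (Matrix.vecCons 1 fun i => i.succ.succ.succ.succ)
  let G : (Fin (k + 4) → ℕ) → ℕ := fun w => g (w (e 0)) (w (e 1)) fun i => w (e i.succ.succ)
  let T' : (Fin (k + 4) → ℕ) → ℕ := fun w => T fun i => w (e i)
  have hG : Computes G T' := hg.rename e
  -- `Computes.primrec` wants bounds at all arguments, whereas `B` and `τ` are bounds only when the
  -- two extra variables hold `s v` and `n v`. Exact maxima serve in general and are compared with
  -- `B` and `τ` afterwards.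
  let B' : (Fin (k + 2) → ℕ) → ℕ := fun v => (Finset.range (v 1 + 1)).sup fun i => recValue G v i
  let τ' : (Fin (k + 2) → ℕ) → ℕ := fun v => (Finset.range (v 1)).sup fun i =>
    T' (Matrix.vecCons i (Matrix.vecCons (recValue G v i) v))
  have h₁ := hG.primrec B' τ'
    (fun v i hi => Finset.le_sup (f := fun i => recValue G v i)
      (Finset.mem_range.2 (Nat.lt_succ_of_le hi)))
    (fun v i hi => Finset.le_sup (f := fun i =>
      T' (Matrix.vecCons i (Matrix.vecCons (recValue G v i) v))) (Finset.mem_range.2 hi))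
  have h₂ := (h₁.bind (hs.rename Fin.succ)).bind hn
  have hrec : ∀ v i, recValue G (Matrix.vecCons (s v) (Matrix.vecCons (n v) v)) i =
      Nat.rec (s v) (fun i a => g i a v) i := by
    intro v i
    induction i with
    | zero => rfl
    | succ i ih => rw [recValue_succ, ih]; rfl
  have hf : (fun v => Nat.rec (s v) (fun i a => g i a v) (n v)) =
      fun v => recValue G (Matrix.vecCons (s v) (Matrix.vecCons (n v) v)) (n v) :=
    funext fun v => (hrec v _).symm
  rw [hf]
  refine Computes.mono h₂ fun v => ?_
  have hB' : B' (Matrix.vecCons (s v) (Matrix.vecCons (n v) v)) ≤ B v :=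
    Finset.sup_le fun i hi => (hrec v i).trans_le
      (hB v i (Nat.lt_succ_iff.1 (Finset.mem_range.1 hi)))
  have hτ' : τ' (Matrix.vecCons (s v) (Matrix.vecCons (n v) v)) ≤ τ v :=
    Finset.sup_le fun i hi => by
      have hi' : i < n v := Finset.mem_range.1 hi
      have he : ∀ a, (fun j => (Matrix.vecCons i (Matrix.vecCons a (Matrix.vecCons (s v)
          (Matrix.vecCons (n v) v))) : Fin (k + 4) → ℕ) (e j)) =
          Matrix.vecCons i (Matrix.vecCons a v) := fun a => by
        funext j
        refine Fin.cases rfl (fun j => Fin.cases rfl (fun j => rfl) j) j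
      exact (congrArg T (he _)).trans_le (hτ v i hi' _ ((hrec v i).trans_le (hB v i hi'.le)))
  refine Nat.add_le_add le_rfl (Nat.add_le_add (Nat.add_le_add le_rfl (Nat.add_le_add
    (Nat.mul_le_mul le_rfl (Nat.add_le_add (Nat.add_le_add hτ' (Nat.mul_le_mul le_rfl hB'))
      le_rfl)) le_rfl)) le_rfl)

/-! ### Polynomially bounded functions -/

/-- `f` is bounded by a polynomial in its variables. -/
def PolyBd (f : (Fin k → ℕ) → ℕ) : Prop := ∃ c, ∀ v, f v ≤ (∑ i, v i + 2) ^ c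

namespace PolyBd

variable {f g : (Fin k → ℕ) → ℕ}

theorem mono (hg : PolyBd g) (h : ∀ v, f v ≤ g v) : PolyBd f :=
  hg.imp fun _ hc v => (h v).trans (hc v)

theorem const (a : ℕ) : PolyBd (fun _ : Fin k → ℕ => a) :=
  ⟨a, fun v => Nat.lt_two_pow_self.le.trans (Nat.pow_le_pow_left (by lia) a)⟩

theorem proj (i : Fin k) : PolyBd (fun v => v i) :=
  ⟨1, fun v => by
    have := Finset.single_le_sum (f := v) (fun _ _ => Nat.zero_le _) (Finset.mem_univ i)
    lia⟩

theorem mul (hf : PolyBd f) (hg : PolyBd g) : PolyBd (fun v => f v * g v) :=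
  let ⟨c, hc⟩ := hf; let ⟨d, hd⟩ := hg
  ⟨c + d, fun v => by rw [pow_add]; exact Nat.mul_le_mul (hc v) (hd v)⟩

theorem add (hf : PolyBd f) (hg : PolyBd g) : PolyBd (fun v => f v + g v) := by
  obtain ⟨c, hc⟩ := hf
  obtain ⟨d, hd⟩ := hg
  refine ⟨c + d + 1, fun v => ?_⟩
  have h₁ := (hc v).trans (Nat.pow_le_pow_right (by lia) (Nat.le_add_right c d))
  have h₂ := (hd v).trans (Nat.pow_le_pow_right (by lia) (Nat.le_add_left d c))
  rw [pow_succ]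
  nlinarith [Nat.zero_le ((∑ i, v i + 2) ^ (c + d)), Nat.zero_le (∑ i, v i)]

theorem pow (hf : PolyBd f) (n : ℕ) : PolyBd (fun v => f v ^ n) := by
  induction n with
  | zero => simpa using const 1
  | succ n ih => simpa only [pow_succ] using ih.mul hf

theorem sum {ι : Type} (s : Finset ι) {f : ι → (Fin k → ℕ) → ℕ} (h : ∀ i, PolyBd (f i)) :
    PolyBd (fun v => ∑ i ∈ s, f i v) := by
  classical
  induction s using Finset.induction_on with
  | empty => simpa using const 0
  | insert i s hi ih => simpa only [Finset.sum_insert hi] using (h i).add ih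

theorem comp {l : ℕ} {F : (Fin l → ℕ) → ℕ} (hF : PolyBd F) {g : Fin l → (Fin k → ℕ) → ℕ}
    (hg : ∀ i, PolyBd (g i)) : PolyBd (fun v => F fun i => g i v) :=
  let ⟨c, hc⟩ := hF
  (((sum Finset.univ hg).add (const 2)).pow c).mono fun v => hc fun i => g i v

theorem vecCons {F : (Fin (k + 1) → ℕ) → ℕ} (hF : PolyBd F) (hg : PolyBd g) :
    PolyBd (fun v => F (Matrix.vecCons (g v) v)) := by
  have := hF.comp (g := fun i v => (Matrix.vecCons (g v) v : Fin (k + 1) → ℕ) i) fun i => by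
    refine Fin.cases ?_ (fun i => ?_) i
    · exact hg
    · exact proj i
  exact this

end PolyBd

/-! ### Functions computed in time polynomial in their (unary) arguments -/

/-- `f` is bounded by a polynomial and is computed in polynomial time, its arguments being
written in unary. -/
def PT (f : (Fin k → ℕ) → ℕ) : Prop := PolyBd f ∧ ∃ T, PolyBd T ∧ Computes f T

namespace PT

variable {f g : (Fin k → ℕ) → ℕ}

theorem zero : PT (fun _ : Fin k → ℕ => 0) := ⟨.const 0, _, .const 1, .zero⟩

theorem proj (i : Fin k) : PT (fun v => v i) :=
  ⟨.proj i, _, ((PolyBd.const 7).mul (.proj i)).add (.const 2), .proj i⟩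

theorem succ (hf : PT f) : PT (fun v => f v + 1) :=
  let ⟨hb, _, hT, hc⟩ := hf
  ⟨hb.add (.const 1), _, hT.add (.const 1), hc.succ⟩

theorem const (a : ℕ) : PT (fun _ : Fin k → ℕ => a) := by
  induction a with
  | zero => exact zero
  | succ a ih => exact ih.succ

theorem rename {l : ℕ} {f : (Fin l → ℕ) → ℕ} (hf : PT f) (e : Fin l → Fin k) :
    PT (fun v => f fun i => v (e i)) :=
  let ⟨hb, _, hT, hc⟩ := hf
  ⟨hb.comp fun i => .proj (e i), _, hT.comp fun i => .proj (e i), hc.rename e⟩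

theorem bind {F : (Fin (k + 1) → ℕ) → ℕ} (hF : PT F) (hg : PT g) :
    PT (fun v => F (Matrix.vecCons (g v) v)) :=
  let ⟨hb, _, hT, hc⟩ := hF; let ⟨hb', _, hT', hc'⟩ := hg
  ⟨hb.vecCons hb', _, hT'.add ((hT.vecCons hb').add (((PolyBd.const 2).mul hb').add (.const 1))),
    hc.bind hc'⟩

/-- Arguments are substituted one at a time by `bind`. Letting `F` also see the original variables
makes the induction on `l` go through, with one more variable at each stage. -/
theorem comp_aux (l : ℕ) : ∀ (k : ℕ) (F : (Fin l → ℕ) → (Fin k → ℕ) → ℕ),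
    PT (fun w : Fin (l + k) → ℕ => F (fun i => w (i.castAdd k)) fun j => w (j.natAdd l)) →
    ∀ g : Fin l → (Fin k → ℕ) → ℕ, (∀ i, PT (g i)) → PT (fun v => F (fun i => g i v) v) := by
  induction l with
  | zero =>
    intro k F hF g hg
    have := hF.rename (k := k) (fun i => i.cast (Nat.zero_add k))
    convert this using 3 with v
    funext j; congr 1; ext; simp
  | succ l ih =>
    intro k F hF g hg
    have h := ih (k + 1) (fun u w => F (Matrix.vecCons (w 0) u) fun j => w j.succ) (by
      have := hF.rename (k := l + (k + 1)) (Fin.addCases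
        (Fin.cases (Fin.natAdd l 0) fun i => i.castAdd (k + 1)) fun j => j.succ.natAdd l)
      convert this using 3 with w
      · funext i
        refine Fin.cases ?_ (fun i => ?_) i <;> simp
      · simp) (fun i w => g i.succ fun j => w j.succ) fun i => (hg i.succ).rename Fin.succ
    have := h.bind (hg 0)
    convert this using 3 with v
    · funext i
      refine Fin.cases ?_ (fun i => ?_) i <;> simp
    · simp

theorem comp {l : ℕ} {F : (Fin l → ℕ) → ℕ} (hF : PT F) {g : Fin l → (Fin k → ℕ) → ℕ}
    (hg : ∀ i, PT (g i)) : PT (fun v => F fun i => g i v) :=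
  comp_aux l k (fun u _ => F u) (hF.rename _) g hg

theorem app₅ {op : ℕ → ℕ → ℕ → ℕ → ℕ → ℕ}
    (h : PT fun v : Fin 5 → ℕ => op (v 0) (v 1) (v 2) (v 3) (v 4))
    {a b c d e : (Fin k → ℕ) → ℕ} (ha : PT a) (hb : PT b) (hc : PT c) (hd : PT d) (he : PT e) :
    PT (fun v => op (a v) (b v) (c v) (d v) (e v)) :=
  h.comp (g := ![a, b, c, d, e]) (by intro i; fin_cases i <;> assumption)

theorem app₆ {op : ℕ → ℕ → ℕ → ℕ → ℕ → ℕ → ℕ}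
    (h : PT fun v : Fin 6 → ℕ => op (v 0) (v 1) (v 2) (v 3) (v 4) (v 5))
    {a b c d e f : (Fin k → ℕ) → ℕ} (ha : PT a) (hb : PT b) (hc : PT c) (hd : PT d) (he : PT e)
    (hf : PT f) : PT (fun v => op (a v) (b v) (c v) (d v) (e v) (f v)) :=
  h.comp (g := ![a, b, c, d, e, f]) (by intro i; fin_cases i <;> assumption)

/-- This is limited recursion in the style of Cobham: once the iterates have an a priori polynomial
bound, every round costs polynomial time, and there are polynomially many rounds. -/
theorem natRec {s n : (Fin k → ℕ) → ℕ} {g : ℕ → ℕ → (Fin k → ℕ) → ℕ} (hs : PT s)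
    (hg : PT fun w : Fin (k + 2) → ℕ => g (w 0) (w 1) fun i => w i.succ.succ) (hn : PT n)
    {B : (Fin k → ℕ) → ℕ} (hB : PolyBd B)
    (h : ∀ v, ∀ i ≤ n v, Nat.rec (s v) (fun i a => g i a v) i ≤ B v) :
    PT (fun v => Nat.rec (s v) (fun i a => g i a v) (n v)) := by
  obtain ⟨-, T, ⟨c, hT⟩, hc⟩ := hg
  obtain ⟨hs₀, Ts, hTs, hcs⟩ := hs
  obtain ⟨hn₀, Tn, hTn, hcn⟩ := hn
  refine ⟨hB.mono fun v => h v _ le_rfl, _, ?_,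
    hcs.natRec hc hcn B (fun v => (n v + B v + ∑ i, v i + 2) ^ c) h fun v i hi a ha => ?_⟩
  · exact hTn.add ((hTs.add (((hn₀.add (.const 1)).mul ((((((hn₀.add hB).add
      (.sum _ .proj)).add (.const 2)).pow c).add ((PolyBd.const 10).mul hB)).add (.const 14))).add
      (((PolyBd.const 2).mul hs₀).add (.const 1)))).add (((PolyBd.const 2).mul hn₀).add (.const 1)))
  · refine (hT _).trans (Nat.pow_le_pow_left ?_ c)
    rw [Fin.sum_univ_succ, Fin.sum_univ_succ]
    change i + (a + ∑ i, v i) + 2 ≤ _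
    lia

end PT

end Cmd

end TimeClasses

/-! ### Arithmetic and bounded quantifiers in polynomial time -/

namespace TimeClasses

open Turing Function

namespace Cmd

variable {k : ℕ}

open Classical in
/-- The truth value of a proposition as a number. -/
noncomputable def ind (p : Prop) : ℕ := if p then 1 else 0

theorem ind_true {p : Prop} (h : p) : ind p = 1 := if_pos h

theorem ind_le_one (p : Prop) : ind p ≤ 1 := by unfold ind; split_ifs <;> lia

theorem ind_eq_one {p : Prop} : ind p = 1 ↔ p := by unfold ind; split_ifs <;> simp_all

namespace PT

variable {f g h : (Fin k → ℕ) → ℕ}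

theorem of_eq (hf : PT f) (e : ∀ v, f v = g v) : PT g := (funext e : f = g) ▸ hf

theorem add (hf : PT f) (hg : PT g) : PT (fun v => f v + g v) := by
  have e : ∀ a i : ℕ, Nat.rec a (fun _ x => x + 1) i = a + i := fun a i => by
    induction i with
    | zero => rfl
    | succ i ih => exact congrArg (· + 1) ih
  exact (natRec (g := fun _ a _ => a + 1) hf (.succ (.proj 1)) hg (hf.1.add hg.1)
    fun v i hi => (e (f v) i).trans_le (by lia)).of_eq fun v => e _ _

theorem mul (hf : PT f) (hg : PT g) : PT (fun v => f v * g v) := by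
  have e : ∀ a i : ℕ, Nat.rec 0 (fun _ x => x + a) i = a * i := fun a i => by
    induction i with
    | zero => rfl
    | succ i ih => exact congrArg (· + a) ih
  exact (natRec (g := fun _ a v => a + f v) zero (.add (.proj 1) (hf.rename _)) hg (hf.1.mul hg.1)
    fun v i hi => (e (f v) i).trans_le (Nat.mul_le_mul le_rfl hi)).of_eq fun v => e _ _

theorem pred (hf : PT f) : PT (fun v => f v - 1) := by
  have e : ∀ i : ℕ, Nat.rec 0 (fun j _ => j) i = i - 1 := fun i => by
    cases i <;> rfl
  exact (natRec (g := fun j _ _ => j) zero (.proj 0) hf hf.1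
    fun v i hi => (e i).trans_le (by lia)).of_eq fun v => e _

theorem sub (hf : PT f) (hg : PT g) : PT (fun v => f v - g v) := by
  have e : ∀ a i : ℕ, Nat.rec a (fun _ x => x - 1) i = a - i := fun a i => by
    induction i with
    | zero => rfl
    | succ i ih => exact congrArg (· - 1) ih
  exact (natRec (g := fun _ a _ => a - 1) hf (.pred (.proj 1)) hg hf.1
    fun v i hi => (e (f v) i).trans_le (by lia)).of_eq fun v => e _ _

theorem pow (hf : PT f) (n : ℕ) : PT (fun v => f v ^ n) := by
  induction n with
  | zero => simpa using const 1
  | succ n ih => simpa only [pow_succ] using ih.mul hf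

end PT

/-- A predicate that is decided in time polynomial in its (unary) arguments. -/
def PTP (p : (Fin k → ℕ) → Prop) : Prop := PT fun v => ind (p v)

namespace PTP

variable {f g : (Fin k → ℕ) → ℕ} {p q : (Fin k → ℕ) → Prop}

theorem of_iff (hp : PTP p) (h : ∀ v, p v ↔ q v) : PTP q :=
  (funext fun v => propext (h v) : p = q) ▸ hp

theorem le (hf : PT f) (hg : PT g) : PTP (fun v => f v ≤ g v) :=
  ((PT.const 1).sub (hf.sub hg)).of_eq fun v => by
    unfold ind; split_ifs <;> lia

theorem not (hp : PTP p) : PTP (fun v => ¬p v) :=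
  ((PT.const 1).sub hp).of_eq fun v => by
    unfold ind; split_ifs <;> lia

theorem and (hp : PTP p) (hq : PTP q) : PTP (fun v => p v ∧ q v) :=
  (PT.mul hp hq).of_eq fun v => by
    unfold ind; split_ifs <;> simp_all

theorem lt (hf : PT f) (hg : PT g) : PTP (fun v => f v < g v) :=
  (le hg hf).not.of_iff fun _ => not_le

theorem eq (hf : PT f) (hg : PT g) : PTP (fun v => f v = g v) :=
  ((le hf hg).and (le hg hf)).of_iff fun _ => le_antisymm_iff.symm

theorem all {p : ℕ → (Fin k → ℕ) → Prop} (hf : PT f)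
    (hp : PTP fun w : Fin (k + 1) → ℕ => p (w 0) fun i => w i.succ) :
    PTP (fun v => ∀ i < f v, p i v) := by
  have e : ∀ v n, Nat.rec 1 (fun i x => x * ind (p i v)) n = ind (∀ i < n, p i v) := by
    intro v n
    induction n with
    | zero => exact (ind_true (by simp)).symm
    | succ n ih =>
      refine (congrArg (· * ind (p n v)) ih).trans ?_
      simp only [Nat.forall_lt_succ_right]
      unfold ind; split_ifs <;> simp_all
  exact (PT.natRec (g := fun i x v => x * ind (p i v)) (.const 1)
    ((PT.proj 1).mul (PT.rename (f := fun w : Fin (k + 1) → ℕ => ind (p (w 0) fun i => w i.succ))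
      hp (Fin.cases 0 fun i => i.succ.succ))) hf (.const 1)
    fun v i hi => (e v i).trans_le (ind_le_one _)).of_eq fun v => e v _

theorem ex {p : ℕ → (Fin k → ℕ) → Prop} (hf : PT f)
    (hp : PTP fun w : Fin (k + 1) → ℕ => p (w 0) fun i => w i.succ) :
    PTP (fun v => ∃ i < f v, p i v) :=
  (all (p := fun i v => ¬p i v) hf hp.not).not.of_iff fun v => by push Not; rfl

end PTP

namespace PT

variable {f g h : (Fin k → ℕ) → ℕ}

theorem ite {p : (Fin k → ℕ) → Prop} [∀ v, Decidable (p v)] (hp : PTP p) (hf : PT f) (hg : PT g) :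
    PT (fun v => if p v then f v else g v) :=
  ((PT.mul hp hf).add (PT.mul hp.not hg)).of_eq fun v => by
    by_cases h : p v <;> simp [ind, h]

theorem min (hf : PT f) (hg : PT g) : PT (fun v => min (f v) (g v)) :=
  (PT.ite (PTP.le hf hg) hf hg).of_eq fun v => by rw [min_def]

/-- The quotient counts the `i` below the dividend with `(i + 1) * b ≤ a`; the test `0 < b` gives
division by zero the value `0`. -/
theorem div (hf : PT f) (hg : PT g) : PT (fun v => f v / g v) := by
  have e : ∀ a b i : ℕ, Nat.rec 0 (fun i x => if 0 < b ∧ (i + 1) * b ≤ a then x + 1 else x) i =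
      Min.min i (a / b) := fun a b i => by
    induction i with
    | zero => simp
    | succ i ih =>
      refine (congrArg (fun x => if 0 < b ∧ (i + 1) * b ≤ a then x + 1 else x) ih).trans ?_
      rcases b.eq_zero_or_pos with rfl | hb
      · simp
      · simp only [hb, true_and, ← Nat.le_div_iff_mul_le hb]
        split_ifs <;> lia
  exact (natRec (g := fun i x v => if 0 < g v ∧ (i + 1) * g v ≤ f v then x + 1 else x) zero
    (PT.ite ((PTP.lt zero (hg.rename _)).and (PTP.le ((PT.succ (.proj 0)).mul (hg.rename _))
      (hf.rename _))) (.succ (.proj 1)) (.proj 1)) hf hf.1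
    fun v i hi => (e (f v) (g v) i).trans_le (by lia)).of_eq fun v => (e _ _ _).trans
      (min_eq_right (Nat.div_le_self _ _))

theorem mod (hf : PT f) (hg : PT g) : PT (fun v => f v % g v) :=
  (hf.sub (hg.mul (hf.div hg))).of_eq fun v => by
    have := Nat.mod_add_div (f v) (g v)
    lia

/-- The digit of `H` at place `i` in base `N`. -/
def _root_.TimeClasses.digit (N H i : ℕ) : ℕ := H / N ^ i % N

/-- The power itself may be exponentially large, so it is never formed: the dividend is divided by
the base repeatedly. -/
theorem div_pow (hf : PT f) (hg : PT g) (hh : PT h) : PT (fun v => f v / g v ^ h v) := by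
  have e : ∀ a b i : ℕ, Nat.rec a (fun _ x => x / b) i = a / b ^ i := fun a b i => by
    induction i with
    | zero => simp
    | succ i ih => exact (congrArg (· / b) ih).trans (by rw [Nat.div_div_eq_div_mul, pow_succ])
  exact (natRec (g := fun _ a v => a / g v) hf (.div (.proj 1) (hg.rename _)) hh hf.1
    fun v i hi => (e (f v) (g v) i).trans_le (Nat.div_le_self _ _)).of_eq fun v => e _ _ _

theorem digit (hf : PT f) (hg : PT g) (hh : PT h) :
    PT (fun v => digit (f v) (g v) (h v)) :=
  .mod (.div_pow hg hf hh) hf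

/-- Powers of two, cut off at `B`. -/
theorem min_two_pow (hf : PT f) (hg : PT g) : PT (fun v => Min.min (g v) (2 ^ f v)) := by
  have e : ∀ a i : ℕ, Nat.rec (Min.min a 1) (fun _ x => Min.min a (2 * x)) i = Min.min a (2 ^ i) :=
    fun a i => by
      induction i with
      | zero => simp
      | succ i ih =>
        refine (congrArg (fun x => Min.min a (2 * x)) ih).trans ?_
        rw [pow_succ]
        lia
  exact (natRec (g := fun _ a v => Min.min (g v) (2 * a)) (.min hg (.const 1))
    (.min (hg.rename _) (.mul (.const 2) (.proj 1))) hf hg.1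
    fun v i hi => (e (g v) i).trans_le (min_le_left _ _)).of_eq fun v => e _ _

end PT

/-- Powers of two are computed in time polynomial in their values. -/
theorem exists_computes_two_pow : ∃ c, Computes (fun v : Fin 1 → ℕ => 2 ^ v 0)
    (fun v => (2 ^ v 0 + 2) ^ c) := by
  have e : ∀ i : ℕ, Nat.rec 1 (fun _ x => x + x) i = 2 ^ i := fun i => by
    induction i with
    | zero => simp
    | succ i ih => exact (congrArg (fun x => x + x) ih).trans (by rw [pow_succ]; lia)
  obtain ⟨-, T₁, ⟨c₁, hT₁⟩, h₁⟩ := PT.const (k := 1) 1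
  obtain ⟨-, T₂, ⟨c₂, hT₂⟩, h₂⟩ := PT.proj (k := 1) 0
  obtain ⟨-, T₃, ⟨c₃, hT₃⟩, h₃⟩ := PT.add (PT.proj (k := 3) 1) (PT.proj 1)
  have hb := h₁.natRec (g := fun _ a _ => a + a) h₃ h₂ (fun v => 2 ^ v 0)
    (fun v => (3 * 2 ^ v 0 + 2) ^ c₃)
    (fun v i hi => (e i).trans_le (Nat.pow_le_pow_right (by lia) hi))
    (fun v i hi a ha => (hT₃ _).trans (Nat.pow_le_pow_left (by
      have : v 0 < 2 ^ v 0 := Nat.lt_two_pow_self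
      simp only [Fin.sum_univ_succ, Fin.sum_univ_zero]
      change i + (a + (v 0 + 0)) + 2 ≤ _
      lia) _))
  obtain ⟨c, hc⟩ : PolyBd fun v : Fin 1 → ℕ => (v 0 + 2) ^ c₂ + ((v 0 + 2) ^ c₁ +
      ((v 0 + 1) * ((3 * v 0 + 2) ^ c₃ + 10 * v 0 + 14) + (2 * 1 + 1)) + (2 * v 0 + 1)) := by
    have := PolyBd.proj (0 : Fin 1)
    exact ((this.add (.const 2)).pow _).add ((((this.add (.const 2)).pow _).add
      (((this.add (.const 1)).mul ((((((PolyBd.const 3).mul this).add (.const 2)).pow _).add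
      ((PolyBd.const 10).mul this)).add (.const 14))).add (.const _))).add
      (((PolyBd.const 2).mul this).add (.const 1)))
  refine ⟨c, ?_⟩
  have hf : (fun v : Fin 1 → ℕ => 2 ^ v 0) = fun v => Nat.rec 1 (fun _ x => x + x) (v 0) :=
    funext fun v => (e _).symm
  rw [hf]
  refine hb.mono fun v => ?_
  -- The running time is not polynomial in the exponent, but replacing the exponent by the larger
  -- number `2 ^ v 0` bounds it by a polynomial in the value.
  have h := hc fun _ => 2 ^ v 0
  have h' : v 0 < 2 ^ v 0 := Nat.lt_two_pow_self
  have k₁ := hT₁ v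
  have k₂ := hT₂ v
  simp only [Fin.sum_univ_succ, Fin.sum_univ_zero, add_zero] at h k₁ k₂
  refine le_trans ?_ h
  have k₁' := k₁.trans (Nat.pow_le_pow_left (Nat.add_le_add_right h'.le 2) c₁)
  have k₂' := k₂.trans (Nat.pow_le_pow_left (Nat.add_le_add_right h'.le 2) c₂)
  have k₃' : (v 0 + 1) * ((3 * 2 ^ v 0 + 2) ^ c₃ + 10 * 2 ^ v 0 + 14) ≤
      (2 ^ v 0 + 1) * ((3 * 2 ^ v 0 + 2) ^ c₃ + 10 * 2 ^ v 0 + 14) :=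
    Nat.mul_le_mul (by lia) le_rfl
  lia

end Cmd

end TimeClasses

namespace TimeClasses

open Turing Function

/-! ### A universal machine acting on histories

A machine with finitely many stacks is run by recording the control states it goes through.  The
record is a number `H` whose digits in base `N` are the control states, the current one being the
least significant.  The top of a stack is found by scanning the record backwards.  The behaviour of
the control states is tabulated by Gödel's beta function, with parameters `p` and `q`. -/

/-- Gödel's beta function. -/
def betaAt (p q i : ℕ) : ℕ := p % ((i + 1) * q + 1)

/-- What the control state `c` does: `1` for a push, `2` for a pop, anything else does not change
the stacks. -/
def kind (p q c : ℕ) : ℕ := betaAt p q c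

/-- The stack used by the control state `c`. -/
def stk (N p q c : ℕ) : ℕ := betaAt p q (N + c)

/-- The control state after `c`, when `m` is the control state that pushed the symbol on top. -/
def nxt (N p q c m : ℕ) : ℕ := betaAt p q (2 * N + c * N + m)

/-- One step of the backward search for the symbol on top of stack `s`: the accumulator is `N + d`
if the symbol has not been found and is now at depth `d`, else it is the control state that pushed
the symbol. -/
def scanStep (N p q s a c : ℕ) : ℕ :=
  if a < N then a
  else if kind p q c = 1 ∧ stk N p q c = s then (if a = N then c else a - 1)
  else if kind p q c = 2 ∧ stk N p q c = s then a + 1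
  else a

/-- The control state that pushed the symbol on top of stack `s`, or `0`; the search looks at `V`
digits of `H`. -/
def scan (N p q s V H : ℕ) : ℕ :=
  let a := Nat.rec N (fun i a => scanStep N p q s a (digit N H i)) V
  if a < N then a else 0

/-- One step of the universal machine, with values cut off at `V`. -/
def histStep (N p q V H : ℕ) : ℕ :=
  min V (nxt N p q (H % N) (scan N p q (stk N p q (H % N)) V (H / N)) + N * H)

/-- The history after `t` steps. -/
def histRun (N p q V t H : ℕ) : ℕ :=
  Nat.rec H (fun _ h => histStep N p q V h) t

/-- The initial history: the input `Y` of length `n` is pushed on top of the history `G`, which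
has pushed the advice. -/
def histInit (N V n G Y : ℕ) : ℕ :=
  min V (4 + N * Nat.rec G (fun i a => min V (N * a + (1 + Y / 2 ^ i % 2))) n)

/-- Whether the machine with description `D` accepts the input `Y` of length `n` in time `t`. -/
def Accepts (V t n D Y : ℕ) : Prop :=
  histRun (D % n) (D / n % n) (D / n / n % n) V t
    (histInit (D % n) V n (D / n / n / n) Y) % (D % n) = 5

/-- `F` is a truth table that is different from those of all descriptions. -/
def Hard (V t E Q n F : ℕ) : Prop :=
  ∀ D < Q - 1, ∃ Y < E, ¬(F / 2 ^ Y % 2 = 1 ↔ Accepts V t n D Y)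

/-- The diagonal predicate: the bit at `X` of the least hard truth table. -/
def Diag (V t E Q n X : ℕ) : Prop :=
  ∃ F < Q, Hard V t E Q n F ∧ (∀ F' < F, ¬Hard V t E Q n F') ∧ F / 2 ^ X % 2 = 1

/-- The diagonal predicate with the parameters computed from `n` and from a bound `V`. -/
def DiagAt (j V n X : ℕ) : Prop :=
  Diag V (min V (2 ^ n ^ j)) (min V (2 ^ n)) (min V (2 ^ min V (2 ^ n))) n X

/-! ### The universal machine and the diagonal predicate in polynomial time -/

namespace Cmd

variable {k : ℕ} {a b c d e f : (Fin k → ℕ) → ℕ}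

theorem PTP.iff {p q : (Fin k → ℕ) → Prop} (hp : PTP p) (hq : PTP q) :
    PTP (fun v => p v ↔ q v) :=
  (PTP.eq hp hq).of_iff fun v => by unfold ind; split_ifs <;> simp_all

namespace PT

theorem betaAt (ha : PT a) (hb : PT b) (hc : PT c) : PT (fun v => betaAt (a v) (b v) (c v)) :=
  .mod ha (.succ (.mul (.succ hc) hb))

theorem kind (ha : PT a) (hb : PT b) (hc : PT c) : PT (fun v => kind (a v) (b v) (c v)) :=
  .betaAt ha hb hc

theorem stk (ha : PT a) (hb : PT b) (hc : PT c) (hd : PT d) :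
    PT (fun v => stk (a v) (b v) (c v) (d v)) :=
  .betaAt hb hc (.add ha hd)

theorem nxt (ha : PT a) (hb : PT b) (hc : PT c) (hd : PT d) (he : PT e) :
    PT (fun v => nxt (a v) (b v) (c v) (d v) (e v)) :=
  .betaAt hb hc (.add (.add (.mul (.const 2) ha) (.mul hd ha)) he)

theorem scanStep : PT fun v : Fin 6 → ℕ => scanStep (v 0) (v 1) (v 2) (v 3) (v 4) (v 5) :=
  .ite (.lt (.proj 4) (.proj 0)) (.proj 4)
    (.ite (.and (.eq (.kind (.proj 1) (.proj 2) (.proj 5)) (.const 1))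
        (.eq (.stk (.proj 0) (.proj 1) (.proj 2) (.proj 5)) (.proj 3)))
      (.ite (.eq (.proj 4) (.proj 0)) (.proj 5) (.pred (.proj 4)))
      (.ite (.and (.eq (.kind (.proj 1) (.proj 2) (.proj 5)) (.const 2))
        (.eq (.stk (.proj 0) (.proj 1) (.proj 2) (.proj 5)) (.proj 3)))
      (.succ (.proj 4)) (.proj 4)))

theorem digit_le (N H i : ℕ) : TimeClasses.digit N H i ≤ H :=
  (Nat.mod_le _ _).trans (Nat.div_le_self _ _)

theorem scan : PT fun v : Fin 6 → ℕ => scan (v 0) (v 1) (v 2) (v 3) (v 4) (v 5) := by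
  have h : PT fun v : Fin 6 → ℕ => Nat.rec (v 0)
      (fun i a => TimeClasses.scanStep (v 0) (v 1) (v 2) (v 3) a (TimeClasses.digit (v 0) (v 5) i))
      (v 4) :=
    natRec (g := fun i a v =>
        TimeClasses.scanStep (v 0) (v 1) (v 2) (v 3) a (TimeClasses.digit (v 0) (v 5) i))
      (.proj 0) (.app₆ .scanStep (.proj _) (.proj _) (.proj _) (.proj _) (.proj 1)
        (.digit (.proj _) (.proj _) (.proj 0))) (.proj 4)
      -- The accumulator starts at `N`, grows by at most one per round, or becomes a digit of `H`;
      -- hence the bound `N + V + H`.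
      (((PolyBd.proj 0).add (.proj 4)).add (.proj 5)) fun v i hi => by
        have : (Nat.rec (v 0) (fun i a => TimeClasses.scanStep (v 0) (v 1) (v 2) (v 3) a
            (TimeClasses.digit (v 0) (v 5) i)) i : ℕ) ≤ v 0 + i + v 5 := by
          clear hi
          induction i with
          | zero => exact (Nat.le_add_right _ _)
          | succ i ih =>
            change TimeClasses.scanStep (v 0) (v 1) (v 2) (v 3)
              (Nat.rec (v 0) (fun i a => TimeClasses.scanStep (v 0) (v 1) (v 2) (v 3) a
                (TimeClasses.digit (v 0) (v 5) i)) i) (TimeClasses.digit (v 0) (v 5) i) ≤ _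
            have := digit_le (v 0) (v 5) i
            unfold TimeClasses.scanStep at ih ⊢
            split_ifs <;> lia
        lia
  exact .ite (.lt h (.proj 0)) h (.const 0)

theorem histStep : PT fun v : Fin 5 → ℕ => histStep (v 0) (v 1) (v 2) (v 3) (v 4) :=
  .min (.proj 3) (.add (.nxt (.proj 0) (.proj 1) (.proj 2) (.mod (.proj 4) (.proj 0))
    (.app₆ .scan (.proj 0) (.proj 1) (.proj 2)
      (.stk (.proj 0) (.proj 1) (.proj 2) (.mod (.proj 4) (.proj 0))) (.proj 3)
      (.div (.proj 4) (.proj 0)))) (.mul (.proj 0) (.proj 4)))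

/-- The history gains a digit per step and would have exponential size in `t`. The cut-off at `V`
supplies the bound that `natRec` needs. -/
theorem histRun : PT fun v : Fin 6 → ℕ => histRun (v 0) (v 1) (v 2) (v 3) (v 4) (v 5) :=
  natRec (g := fun _ a v => TimeClasses.histStep (v 0) (v 1) (v 2) (v 3) a)
    (.proj 5) (.app₅ .histStep (.proj _) (.proj _) (.proj _) (.proj _) (.proj 1)) (.proj 4)
    ((PolyBd.proj 3).add (.proj 5)) fun v i _ => by
      cases i with
      | zero => exact Nat.le_add_left _ _
      | succ i => exact (min_le_left _ _).trans (Nat.le_add_right _ _)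

theorem histInit : PT fun v : Fin 5 → ℕ => histInit (v 0) (v 1) (v 2) (v 3) (v 4) := by
  have h : PT fun v : Fin 5 → ℕ => Nat.rec (v 3)
      (fun i a => Min.min (v 1) (v 0 * a + (1 + v 4 / 2 ^ i % 2))) (v 2) :=
    natRec (g := fun i a v => Min.min (v 1) (v 0 * a + (1 + v 4 / 2 ^ i % 2)))
      (.proj 3) (.min (.proj _) (.add (.mul (.proj _) (.proj 1)) (.add (.const 1)
        (.mod (.div_pow (.proj _) (.const 2) (.proj 0)) (.const 2))))) (.proj 2)
      ((PolyBd.proj 1).add (.proj 3)) fun v i _ => by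
        cases i with
        | zero => exact Nat.le_add_left _ _
        | succ i => exact (min_le_left _ _).trans (Nat.le_add_right _ _)
  exact .min (.proj 1) (.add (.const 4) (.mul (.proj 0) h))

end PT

theorem PTP.accepts (ha : PT a) (hb : PT b) (hc : PT c) (hd : PT d) (he : PT e) :
    PTP (fun v => Accepts (a v) (b v) (c v) (d v) (e v)) :=
  have h₀ := hd.mod hc
  .eq (.mod (.app₆ .histRun h₀ ((hd.div hc).mod hc) (((hd.div hc).div hc).mod hc) ha hb
    (.app₅ .histInit h₀ ha hc (((hd.div hc).div hc).div hc) he)) h₀) (.const 5)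

theorem PTP.hard (ha : PT a) (hb : PT b) (hc : PT c) (hd : PT d) (he : PT e) (hf : PT f) :
    PTP (fun v => Hard (a v) (b v) (c v) (d v) (e v) (f v)) :=
  .all (hd.sub (.const 1)) (.ex (hc.rename _) (.not (.iff
    (.eq (.mod (.div_pow ((hf.rename _).rename _) (.const 2) (.proj 0)) (.const 2)) (.const 1))
    (.accepts ((ha.rename _).rename _) ((hb.rename _).rename _) ((he.rename _).rename _)
      (.proj _) (.proj 0)))))

/-- The search is exhaustive, and is polynomial because the ranges `Q` and `E` are themselves unary
arguments. -/
theorem PTP.diag (ha : PT a) (hb : PT b) (hc : PT c) (hd : PT d) (he : PT e) (hf : PT f) :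
    PTP (fun v => Diag (a v) (b v) (c v) (d v) (e v) (f v)) :=
  .ex hd (.and (.hard (ha.rename _) (hb.rename _) (hc.rename _) (hd.rename _) (he.rename _)
    (.proj 0)) (.and (.all (.proj 0) (.not (.hard ((ha.rename _).rename _) ((hb.rename _).rename _)
      ((hc.rename _).rename _) ((hd.rename _).rename _) ((he.rename _).rename _) (.proj 0))))
    (.eq (.mod (.div_pow (.proj 0) (.const 2) (hf.rename _)) (.const 2)) (.const 1))))

theorem PTP.diagAt (j : ℕ) : PTP (fun v : Fin 3 → ℕ => DiagAt j (v 0) (v 1) (v 2)) :=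
  have hE := PT.min_two_pow (.proj 1) (.proj 0)
  .diag (.proj 0) (.min_two_pow (.pow (.proj 1) j) (.proj 0)) hE (.min_two_pow hE (.proj 0))
    (.proj 1) (.proj 2)

end Cmd

end TimeClasses

/-! ### Reading binary input, and the diagonal language in doubly exponential time -/

namespace TimeClasses

open Turing Function

/-- The number with the given bits, the first one being the most significant. -/
def natOf (x : List Bool) : ℕ := x.foldl (fun a b => 2 * a + b.toNat) 0

theorem natOf_append (x : List Bool) (b : Bool) : natOf (x ++ [b]) = 2 * natOf x + b.toNat := by
  simp [natOf]

theorem natOf_lt (x : List Bool) : natOf x < 2 ^ x.length := by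
  induction x using List.reverseRecOn with
  | nil => simp [natOf]
  | append_singleton x b ih =>
    rw [natOf_append, List.length_append, List.length_singleton, pow_succ]
    cases b <;> simp <;> lia

namespace Cmd

/-- Double a register, using an empty one. -/
def double (a z : ℕ) : Cmd :=
  .seq (.whl a (.seq (.pop a) (.seq (.push z true) (.push z true)))) (move z a)

theorem runs_double {a z : ℕ} (n : ℕ) (haz : a ≠ z) {S S' : St} (ha : S a = rep n) (hz : S z = [])
    (hS : S' = update S a (rep (2 * n))) : Runs (double a z) S S' (10 * n + 2) := by
  have := Runs.whl (r := a) (c := .seq (.pop a) (.seq (.push z true) (.push z true)))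
    (fun i => update (update S a (rep (n - i))) z (rep (2 * i))) n 3
    (fun i hi => by simpa [haz, Nat.sub_eq_zero_iff_le] using hi)
    (fun i hi => (Runs.pop
      (S' := update (update S a (rep (n - (i + 1)))) z (rep (2 * i))) _ (by
        funext r
        simp only [update_apply, haz, if_true, if_false, tail_rep, Nat.sub_sub]
        split_ifs <;> simp_all)).seq ((Runs.push
      (S' := update (update S a (rep (n - (i + 1)))) z (rep (2 * i + 1))) _ _ (by
        funext r
        simp only [update_apply, if_true]
        split_ifs <;> simp_all [List.replicate_succ])).seq (Runs.push _ _ (by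
        funext r
        simp only [update_apply, if_true]
        split_ifs <;> simp_all [List.replicate_succ, Nat.mul_succ]))))
    (by simp [haz])
  have e : update (update S a (rep (n - 0))) z (rep (2 * 0)) = S := by
    funext r; simp only [update_apply]; split_ifs <;> simp_all
  simp only [e, Nat.sub_self] at this
  refine (this.seq (runs_move (S' := S') (2 * n) 0 haz.symm (by simp) (by simp [haz]) ?_)).mono
    (by lia)
  subst hS
  funext r; simp only [update_apply]; split_ifs <;> simp_all

/-- Read the input from stack `0`: its length goes to register `1`, its value to register `2`. -/
def readInput : Cmd :=
  .whl 0 (.ite 0 (.seq (.pop 0) (.seq (double 2 3) (.seq (.push 2 true) (.push 1 true))))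
    (.seq (.pop 0) (.seq (double 2 3) (.push 1 true))))

/-- The stacks after the first part `y` of the input has been read. -/
def readSt (y z : List Bool) : St :=
  update (update (update (fun _ => []) 0 z) 1 (rep y.length)) 2 (rep (natOf y))

theorem runs_readInput (x : List Bool) :
    Runs readInput (update (fun _ => []) 0 x) (readSt x [])
      (x.length * (10 * 2 ^ x.length + 7) + 1) := by
  have := Runs.whl (r := 0) (c := (.ite 0
    (.seq (.pop 0) (.seq (double 2 3) (.seq (.push 2 true) (.push 1 true))))
    (.seq (.pop 0) (.seq (double 2 3) (.push 1 true)))))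
    (fun i => readSt (x.take i) (x.drop i)) x.length (10 * 2 ^ x.length + 6)
    (fun i hi => by simpa [readSt] using hi)
    (fun i hi => by
      have hd : x.drop i = x[i] :: x.drop (i + 1) := List.drop_eq_getElem_cons hi
      have ht : x.take (i + 1) = x.take i ++ [x[i]] := by simp
      have hl : natOf (x.take i) ≤ 2 ^ x.length := (natOf_lt _).le.trans
        (Nat.pow_le_pow_right (by lia) (by simp))
      rw [hd, ht]
      generalize x[i] = b
      generalize x.drop (i + 1) = z
      generalize x.take i = y at *
      have h₁ : Runs (.pop 0) (readSt y (b :: z)) (readSt y z) 1 := .pop _ (by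
        funext r
        simp only [readSt, update_apply]
        split_ifs <;> simp_all)
      have h₂ := runs_double (a := 2) (z := 3) (S := readSt y z) (natOf y) (by decide)
        (by simp [readSt]) (by simp [readSt]) rfl
      cases b with
      | true =>
        refine (Runs.iteTrue (by simp [readSt]) (h₁.seq (h₂.seq ((Runs.push 2 true rfl).seq
          (Runs.push 1 true ?_))))).mono (by lia)
        funext r
        simp only [readSt, update_apply, natOf_append]
        split_ifs <;> simp_all [List.replicate_succ]
      | false =>
        refine (Runs.iteFalse (by simp [readSt]) (h₁.seq (h₂.seq
          (Runs.push 1 true ?_)))).mono (by lia)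
        funext r
        simp only [readSt, update_apply, natOf_append]
        split_ifs <;> simp_all [List.replicate_succ])
    (by simp [readSt])
  have e : readSt (x.take 0) (x.drop 0) = update (fun _ => []) 0 x := by
    funext r
    simp only [readSt, update_apply]
    split_ifs <;> simp_all [natOf]
  simp only [e, List.take_length, List.drop_length] at this
  exact this

/-- A predicate of the length and the value of the input that can be computed is decided by a
program. -/
theorem Computes.exists_decider {f T : (Fin 2 → ℕ) → ℕ} (h : Computes f T) (hf : ∀ v, f v ≤ 1) :
    ∃ c : Cmd, ∀ x : List Bool, Runs c (update (fun _ => []) 0 x)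
      (update (fun _ => []) 0 [decide (f ![x.length, natOf x] = 1)])
      (x.length * (10 * 2 ^ x.length + 7) + T ![x.length, natOf x] +
        2 * x.length + 2 * natOf x + 6) := by
  obtain ⟨c, hc⟩ := h ![1, 2] 3 4 (fun i => by fin_cases i <;> simp) (by lia)
  refine ⟨.seq readInput (.seq c (.seq (clear 1) (.seq (clear 2)
    (.ite 3 (.seq (.pop 3) (.push 0 true)) (.push 0 false))))), fun x => ?_⟩
  set b := f ![x.length, natOf x] with hb
  have h₂ := hc (readSt x []) ![x.length, natOf x]
    (fun i => by fin_cases i <;> simp [readSt]) (by simp [readSt]) (fun r hr => by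
      simp [readSt, (show r ≠ 1 by lia), (show r ≠ 2 by lia)])
  refine ((runs_readInput x).seq (h₂.seq ((runs_clear 1 x.length (by simp [readSt]) rfl).seq
    ((runs_clear 2 (natOf x) (by simp [readSt]) rfl).seq
      (?_ : Runs _ _ _ (1 + (1 + 1))))))).mono (by lia)
  obtain hb' | hb' : b = 0 ∨ b = 1 := by have := hf ![x.length, natOf x]; lia
  · refine (Runs.iteFalse (by simp [← hb, hb']) (.push 0 false ?_)).mono (by lia)
    funext r
    simp only [readSt, update_apply, ← hb, hb']
    split_ifs <;> simp_all
  · refine (Runs.iteTrue (by simp [← hb, hb']) ((Runs.pop 3 rfl).seq (.push 0 true ?_))).mono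
      (by lia)
    funext r
    simp only [readSt, update_apply, ← hb, hb']
    split_ifs <;> simp_all

/-- The cut-off as a function of the length. -/
def cut (J n : ℕ) : ℕ := 2 ^ 2 ^ n ^ J

theorem two_le_cut (J n : ℕ) : 2 ≤ cut J n :=
  Nat.le_self_pow (by positivity) 2

/-- The cut-off is first computed as an iterated power of two and stored in a register; from then on
`DiagAt` costs time polynomial in that register. -/
theorem exists_computes_diagAt (j J : ℕ) : ∃ c, Computes
    (fun v : Fin 2 → ℕ => ind (DiagAt j (cut J (v 0)) (v 0) (v 1)))
    (fun v => (cut J (v 0) + v 0 + v 1 + 2) ^ c) := by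
  obtain ⟨c₀, h₀⟩ := exists_computes_two_pow
  obtain ⟨-, T₁, ⟨c₁, hT₁⟩, h₁⟩ := (PT.proj (0 : Fin 2)).pow J
  obtain ⟨-, T₂, ⟨c₂, hT₂⟩, h₂⟩ := PTP.diagAt j
  have h₃ := (h₀.rename (k := 3) ![0]).bind h₁
  have h₄ := (h₀.rename (k := 3) ![0]).bind h₃
  have h₅ := h₂.bind h₄
  refine ⟨c₁ + c₀ + c₀ + c₂ + 4, Computes.mono h₅ fun v => ?_⟩
  set n := v 0
  set V := cut J n with hV
  have e₀ : n ^ J < 2 ^ n ^ J := Nat.lt_two_pow_self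
  have e₁ : 2 ^ n ^ J < V := Nat.lt_two_pow_self
  set W := V + n + v 1 + 2 with hW
  have k₁ : T₁ v ≤ W ^ c₁ := (hT₁ v).trans (Nat.pow_le_pow_left (by
    simp only [Fin.sum_univ_succ, Fin.sum_univ_zero]
    change n + (v 1 + 0) + 2 ≤ _
    lia) _)
  have k₂ : (2 ^ n ^ J + 2) ^ c₀ ≤ W ^ c₀ := Nat.pow_le_pow_left (by lia) _
  have k₃ : (V + 2) ^ c₀ ≤ W ^ c₀ := Nat.pow_le_pow_left (by lia) _
  have k₄ : T₂ (Matrix.vecCons V v) ≤ W ^ c₂ := (hT₂ _).trans (Nat.pow_le_pow_left (by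
    simp only [Fin.sum_univ_succ, Fin.sum_univ_zero]
    change V + (n + (v 1 + 0)) + 2 ≤ _
    lia) _)
  change T₁ v + ((2 ^ n ^ J + 2) ^ c₀ + (2 * n ^ J + 1)) +
    ((V + 2) ^ c₀ + (2 * 2 ^ n ^ J + 1)) + (T₂ (Matrix.vecCons V v) + (2 * V + 1)) ≤ _
  have hW2 : 4 ≤ W := by have := two_le_cut J n; lia
  have m : ∀ a ≤ c₁ + c₀ + c₀ + c₂ + 1, W ^ a ≤ W ^ (c₁ + c₀ + c₀ + c₂ + 1) := fun a ha =>
    Nat.pow_le_pow_right (by lia) ha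
  have m₁ := m c₁ (by lia)
  have m₂ := m c₀ (by lia)
  have m₃ := m c₂ (by lia)
  have m₄ := m 1 (by lia)
  rw [pow_one] at m₄
  have : W ^ (c₁ + c₀ + c₀ + c₂ + 4) = W ^ (c₁ + c₀ + c₀ + c₂ + 1) * W ^ 3 := by
    rw [← pow_add]
  have h64 : 4 ^ 3 ≤ W ^ 3 := Nat.pow_le_pow_left hW2 3
  rw [this]
  refine le_trans ?_ (Nat.mul_le_mul le_rfl h64)
  lia

/-- For `n ≥ 2` a power of the cut-off is absorbed by raising the exponent `J`. For `n ≤ 1` raising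
it gains nothing, but the cut-off is at most `4`, whence the constant factor. -/
theorem cut_pow_le (J e n : ℕ) :
    cut J n ^ e ≤ 4 ^ e * 2 ^ 2 ^ n ^ (J + e) := by
  rcases Nat.lt_or_ge n 2 with hn | hn
  · have h₁ : cut J n ≤ 4 := by
      have h : n ^ J ≤ 1 := (Nat.pow_le_pow_left (by lia : n ≤ 1) J).trans (by simp)
      exact Nat.pow_le_pow_right (by lia) (Nat.pow_le_pow_right (by lia) h : _ ≤ 2 ^ 1)
    exact (Nat.pow_le_pow_left h₁ e).trans (Nat.le_mul_of_pos_right _ (by positivity))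
  · refine le_trans ?_ (Nat.le_mul_of_pos_left _ (by positivity))
    unfold cut
    rw [← pow_mul]
    refine Nat.pow_le_pow_right (by lia) ?_
    have h₁ : e < 2 ^ e := Nat.lt_two_pow_self
    have h₂ : 1 ≤ n ^ J := Nat.one_le_pow _ _ (by lia)
    have h₃ : n ^ J + e ≤ n ^ (J + e) := by
      rw [pow_add]
      have : 2 ^ e ≤ n ^ e := Nat.pow_le_pow_left hn e
      calc n ^ J + e ≤ n ^ J * (1 + e) := by nlinarith
        _ ≤ n ^ J * n ^ e := Nat.mul_le_mul le_rfl (by lia)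
    calc 2 ^ n ^ J * e ≤ 2 ^ n ^ J * 2 ^ e := Nat.mul_le_mul le_rfl h₁.le
      _ = 2 ^ (n ^ J + e) := (pow_add _ _ _).symm
      _ ≤ _ := Nat.pow_le_pow_right (by lia) h₃

end Cmd

/-- The diagonal language. -/
def diagLanguage (j J : ℕ) : Language Bool :=
  {x | DiagAt j (Cmd.cut J x.length) x.length (natOf x)}

theorem diagLanguage_mem_EEXP (j J : ℕ) (hJ : 1 ≤ J) : diagLanguage j J ∈ EEXP := by
  obtain ⟨c, hc⟩ := Cmd.exists_computes_diagAt j J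
  obtain ⟨d, hd⟩ := hc.exists_decider fun v => Cmd.ind_le_one _
  simp only [EEXP, Set.mem_iUnion]
  -- The predicate costs at most `V ^ (3 * c)` and the remaining work at most `23 * V ^ 2`; the sum
  -- is below `2 ^ 7 * V ^ (3 * c + 2)`, and `V ≥ 2` turns `2 ^ 7` into `V ^ 7`.
  refine ⟨J + (3 * c + 9), d.aux, (4 ^ (3 * c + 9) : ℕ), fun x => ?_⟩
  refine ⟨decide (Cmd.ind (DiagAt j (Cmd.cut J x.length) x.length (natOf x)) = 1), ?_, ?_⟩
  · rw [decide_eq_true_eq]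
    exact Cmd.ind_eq_one
  · obtain ⟨t, ht, he⟩ := hd x
    refine d.outputsWithin x _ he ?_
    set n := x.length
    have hX : natOf x < 2 ^ n := natOf_lt x
    have hn : n < 2 ^ n := Nat.lt_two_pow_self
    set V := Cmd.cut J n with hV
    have hV2 : 2 ≤ V := Cmd.two_le_cut J n
    have hVn : 2 ^ n ≤ V := Nat.pow_le_pow_right (by lia)
      ((Nat.le_self_pow (by lia) n).trans Nat.lt_two_pow_self.le)
    have hb : t + 1 ≤ V ^ (3 * c + 9) := by
      have e₁ : (V + n + natOf x + 2) ^ c ≤ (V ^ 3) ^ c :=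
        Nat.pow_le_pow_left (by nlinarith [Nat.mul_le_mul hV2 hV2]) c
      rw [← pow_mul] at e₁
      have e₂ : t ≤ n * (10 * 2 ^ n + 7) + (V + n + natOf x + 2) ^ c + 2 * n + 2 * natOf x + 6 := ht
      have e₃ : n * (10 * 2 ^ n + 7) ≤ V * (10 * V + 7) :=
        Nat.mul_le_mul (by lia) (by lia)
      have e₄ : 1 ≤ V ^ (3 * c) := Nat.one_le_pow _ _ (by lia)
      have e₅ : 2 ^ 7 ≤ V ^ 7 := Nat.pow_le_pow_left hV2 7
      have e₆ : 2 * V ≤ V * V := Nat.mul_le_mul hV2 le_rfl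
      have e₇ : t + 1 ≤ 23 * (V * V) + V ^ (3 * c) := by
        have : V * (10 * V + 7) = 10 * (V * V) + 7 * V := by ring
        lia
      calc t + 1 ≤ 23 * (V * V) + V ^ (3 * c) := e₇
        _ ≤ 23 * (V * V) * V ^ (3 * c) + V ^ (3 * c) * (V * V) :=
          Nat.add_le_add (Nat.le_mul_of_pos_right _ e₄) (Nat.le_mul_of_pos_right _ (by lia))
        _ ≤ V ^ (3 * c) * (V * V) * 2 ^ 7 := by
          have : 23 * (V * V) * V ^ (3 * c) = 23 * (V ^ (3 * c) * (V * V)) := by ring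
          lia
        _ ≤ V ^ (3 * c) * (V * V) * V ^ 7 := Nat.mul_le_mul le_rfl e₅
        _ = V ^ (3 * c + 9) := by ring
    have := hb.trans (Cmd.cut_pow_le J (3 * c + 9) n)
    change (t : ℝ) + 1 ≤ ((4 ^ (3 * c + 9) : ℕ) : ℝ) * (2 : ℝ) ^ 2 ^ n ^ (J + (3 * c + 9))
    exact_mod_cast this

end TimeClasses

namespace TimeClasses

open Turing Function

/-! ### Simulating a machine on histories -/

namespace HistSim

variable (M : TM2ComputableAux (Option Bool) Bool)

/-- The control states of the history machine that simulates `M`. -/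
inductive Ctl : Type
  | inp (a : Option Bool)
  | start
  | acc
  | rej
  | out
  | run (q : TM2.Stmt M.tm.Γ M.tm.Λ M.tm.σ) (v : M.tm.σ)

variable {M}

namespace Ctl

/-- The symbol that a control state pushes on a given stack. -/
def sym : Ctl M → (k : M.tm.K) → Option (M.tm.Γ k)
  | inp a, k => if h : M.tm.k₀ = k then some (h ▸ M.inputAlphabet.symm a) else none
  | run (.push k' f _) v, k => if h : k' = k then some (h ▸ f v) else none
  | _, _ => none

/-- The kind of a control state: `1` for a push and `2` for a pop. -/
def kind : Ctl M → ℕ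
  | inp _ => 1
  | run (.push _ _ _) _ => 1
  | run (.pop _ _ _) _ => 2
  | _ => 0

/-- The stack used by a control state. -/
def stack : Ctl M → M.tm.K
  | run (.push k _ _) _ => k
  | run (.pop k _ _) _ => k
  | run (.peek k _ _) _ => k
  | out => M.tm.k₁
  | _ => M.tm.k₀

open Classical in
/-- The control state that follows, given the one that pushed the symbol on top. -/
noncomputable def next : Ctl M → Option (Ctl M) → Ctl M
  | inp a, _ => inp a
  | start, _ => run (M.tm.m M.tm.main) M.tm.initialState
  | acc, _ => acc
  | rej, _ => rej
  | out, o => if o.bind (fun c => c.sym M.tm.k₁) = some (M.outputAlphabet.symm true) then acc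
      else rej
  | run (.push _ _ q) v, _ => run q v
  | run (.pop k f q) v, o => run q (f v (o.bind fun c => c.sym k))
  | run (.peek k f q) v, o => run q (f v (o.bind fun c => c.sym k))
  | run (.load f q) v, _ => run q (f v)
  | run (.branch f q₁ q₂) v, _ => run (cond (f v) q₁ q₂) v
  | run (.goto f) v, _ => run (M.tm.m (f v)) v
  | run .halt _, _ => out

/-- The control states that can occur. -/
def Good : Ctl M → Prop
  | run q _ => ∃ l, q ∈ TM2.stmts₁ (M.tm.m l)
  | _ => True

theorem Good.next {c : Ctl M} (hc : c.Good) (o : Option (Ctl M)) : (c.next o).Good := by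
  have sub : ∀ {q q' : TM2.Stmt M.tm.Γ M.tm.Λ M.tm.σ}, q' ∈ TM2.stmts₁ q →
      (∃ l, q ∈ TM2.stmts₁ (M.tm.m l)) → ∃ l, q' ∈ TM2.stmts₁ (M.tm.m l) :=
    fun h ⟨l, hl⟩ => ⟨l, TM2.stmts₁_trans hl h⟩
  match c, hc with
  | inp a, _ => trivial
  | start, _ => exact ⟨_, TM2.stmts₁_self⟩
  | acc, _ => trivial
  | rej, _ => trivial
  | out, _ => simp only [Ctl.next]; split_ifs <;> trivial
  | run (.push _ _ q) v, h =>
    exact sub (by simp [TM2.stmts₁, TM2.stmts₁_self]) h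
  | run (.pop k f q) v, h => exact sub (by simp [TM2.stmts₁, TM2.stmts₁_self]) h
  | run (.peek k f q) v, h => exact sub (by simp [TM2.stmts₁, TM2.stmts₁_self]) h
  | run (.load f q) v, h => exact sub (by simp [TM2.stmts₁, TM2.stmts₁_self]) h
  | run (.branch f q₁ q₂) v, h =>
    refine sub ?_ h
    cases f v <;> simp [TM2.stmts₁, TM2.stmts₁_self]
  | run (.goto f) v, _ => exact ⟨_, TM2.stmts₁_self⟩
  | run .halt _, _ => trivial

/-- There are infinitely many statements over the machine's alphabets; finiteness comes from
allowing only substatements of its program, a set closed under `next`. -/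
theorem finite_good : {c : Ctl M | c.Good}.Finite := by
  have := M.tm.ΛFin
  have := M.tm.σFin
  have h : (⋃ l, {q | q ∈ TM2.stmts₁ (M.tm.m l)}).Finite :=
    Set.finite_iUnion fun l => Finset.finite_toSet (TM2.stmts₁ (M.tm.m l))
  refine ((((Set.finite_range (inp (M := M))).union (Set.toFinite {start, acc, rej, out}))).union
    ((h.prod (Set.finite_univ (α := M.tm.σ))).image fun z => run z.1 z.2)).subset ?_
  intro c hc
  match c, hc with
  | inp a, _ => simp
  | start, _ => simp
  | acc, _ => simp
  | rej, _ => simp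
  | out, _ => simp
  | run q v, ⟨l, hl⟩ =>
    refine Or.inr ⟨(q, v), ⟨Set.mem_iUnion.2 ⟨l, hl⟩, trivial⟩, rfl⟩

/-- The codes of bits, of `start` and of `acc` match the literals in `histInit` and `Accepts`. Code
`0` is reserved for the absence of a control state; decoding it to `acc`, which moves no stack,
makes digits read past the end of a history harmless. -/
theorem exists_code : ∃ (N : ℕ) (code : Ctl M → ℕ) (dec : ℕ → Ctl M), 2 ≤ N ∧
    (∀ c, c.Good → code c ≠ 0 ∧ code c < N ∧ dec (code c) = c) ∧ dec 0 = acc ∧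
    (∀ b : Bool, code (inp (some b)) = 1 + b.toNat) ∧ code start = 4 ∧ code acc = 5 := by
  obtain ⟨e, he⟩ := Set.countable_iff_exists_injOn.1 (finite_good (M := M)).countable
  let code : Ctl M → ℕ := fun c => match c with
    | inp none => 3
    | inp (some b) => 1 + b.toNat
    | start => 4
    | acc => 5
    | rej => 6
    | out => 7
    | run q v => 8 + e (run q v)
  have hinj : Set.InjOn code {c | c.Good} := by
    intro c hc d hd h
    match c, d with
    | inp none, inp none | start, start | acc, acc | rej, rej | out, out => rfl
    | inp (some b), inp (some b') => cases b <;> cases b' <;> simp [code] at h ⊢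
    | run q v, run q' v' => exact he hc hd (by simpa [code] using h)
    | inp none, inp (some b) => cases b <;> simp [code] at h
    | inp (some b), inp none => cases b <;> simp [code] at h
    | inp (some b), start | inp (some b), acc | inp (some b), rej | inp (some b), out
    | inp (some b), run _ _ | start, inp (some b) | acc, inp (some b) | rej, inp (some b)
    | out, inp (some b) | run _ _, inp (some b) => cases b <;> simp [code] at h <;> lia
    | inp none, start | inp none, acc | inp none, rej | inp none, out | inp none, run _ _
    | start, inp none | start, acc | start, rej | start, out | start, run _ _
    | acc, inp none | acc, start | acc, rej | acc, out | acc, run _ _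
    | rej, inp none | rej, acc | rej, start | rej, out | rej, run _ _
    | out, inp none | out, acc | out, rej | out, start | out, run _ _
    | run _ _, inp none | run _ _, acc | run _ _, rej | run _ _, out | run _ _, start =>
      simp [code] at h <;> lia
  obtain ⟨N, hN⟩ := ((finite_good (M := M)).image code).bddAbove
  have h0 : ∀ c, code c ≠ 0 := by
    intro c
    match c with
    | inp none | inp (some b) | start | acc | rej | out | run q v => simp [code]
  classical
  refine ⟨N + 2, code, fun n => if n = 0 then acc else
    @invFunOn _ _ ⟨acc⟩ code {c | c.Good} n, by lia, fun c hc => ⟨h0 c, ?_, ?_⟩, if_pos rfl,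
    fun b => rfl, rfl, rfl⟩
  · have := hN (Set.mem_image_of_mem code hc)
    lia
  · simp only [if_neg (h0 c)]
    have : Nonempty (Ctl M) := ⟨acc⟩
    exact hinj.leftInvOn_invFunOn hc

end Ctl

/-- By the Chinese remainder theorem, two numbers store any finite table; so the size of a machine's
description does not depend on the input length. -/
theorem exists_betaAt (f : ℕ → ℕ) (n : ℕ) : ∃ p q, ∀ i < n, betaAt p q i = f i := by
  let l := (List.range n).map f
  refine ⟨(Nat.unbeta l).unpair.1, (Nat.unbeta l).unpair.2, fun i hi => ?_⟩
  have := Nat.beta_unbeta_coe l ⟨i, by simpa [l] using hi⟩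
  change Nat.beta _ _ = _
  simpa [l] using this

variable (M) in
/-- A coding of the control states that is tabulated by the beta function. -/
structure Table where
  N : ℕ
  p : ℕ
  q : ℕ
  code : Ctl M → ℕ
  dec : ℕ → Ctl M
  ix : M.tm.K → ℕ
  two_le : 2 ≤ N
  ix_inj : Injective ix
  code_ne_zero : ∀ c, c.Good → code c ≠ 0
  code_lt : ∀ c, c.Good → code c < N
  dec_code : ∀ c, c.Good → dec (code c) = c
  code_bit : ∀ b : Bool, code (.inp (some b)) = 1 + b.toNat
  code_start : code .start = 4
  code_acc : code .acc = 5
  kind_zero : kind p q 0 = 0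
  kind_eq : ∀ n < N, kind p q n = (dec n).kind
  stk_eq : ∀ n < N, stk N p q n = ix (dec n).stack
  nxt_eq : ∀ n < N, ∀ m < N,
    nxt N p q n m = code ((dec n).next (if m = 0 then none else some (dec m)))

variable (M) in
theorem exists_table : Nonempty (Table M) := by
  obtain ⟨N, code, dec, hN, h₁, h₂, h₃, h₄, h₅⟩ := Ctl.exists_code (M := M)
  let := M.tm.kFin
  let ix : M.tm.K → ℕ := fun k => Fintype.equivFin M.tm.K k
  -- Three blocks are laid end to end: `N` kinds, `N` stack indices, and an `N` by `N` transition
  -- table indexed by the current state and the state that pushed the top symbol.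
  obtain ⟨p, q, hpq⟩ := exists_betaAt (fun i => if i < N then (dec i).kind else
    if i < 2 * N then ix (dec (i - N)).stack else
    code ((dec ((i - 2 * N) / N)).next
      (if (i - 2 * N) % N = 0 then none else some (dec ((i - 2 * N) % N))))) (2 * N + N * N)
  refine ⟨⟨N, p, q, code, dec, ix, hN, fun a b h => (Fintype.equivFin M.tm.K).injective (Fin.ext h),
    fun c hc => (h₁ c hc).1, fun c hc => (h₁ c hc).2.1, fun c hc => (h₁ c hc).2.2, h₃, h₄, h₅,
    ?_, ?_, ?_, ?_⟩⟩
  · rw [kind, hpq 0 (by lia), if_pos (by lia), h₂]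
    rfl
  · intro n hn
    rw [kind, hpq n (by lia), if_pos hn]
  · intro n hn
    rw [stk, hpq _ (by lia), if_neg (by lia), if_pos (by lia), Nat.add_sub_cancel_left]
  · intro n hn m hm
    have h : n * N + m < N * N := by nlinarith
    have e₀ : 2 * N + n * N + m - 2 * N = n * N + m := by lia
    have e₁ : (n * N + m) / N = n := by
      rw [mul_comm, Nat.mul_add_div (by lia), Nat.div_eq_of_lt hm, add_zero]
    have e₂ : (n * N + m) % N = m := by
      rw [mul_comm, Nat.mul_add_mod, Nat.mod_eq_of_lt hm]
    rw [nxt, hpq _ (by lia), if_neg (by lia), if_neg (by lia), e₀, e₁, e₂]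

end HistSim

end TimeClasses

/-! ### Histories as lists, and the step-by-step simulation -/

namespace TimeClasses

open Turing Function

namespace HistSim

/-- The control state that pushed the symbol at depth `d` of stack `s`, or `0`, for a history given
as a list. -/
def find (N p q s : ℕ) : List ℕ → ℕ → ℕ
  | [], _ => 0
  | c :: h, d => if kind p q c = 1 ∧ stk N p q c = s then (if d = 0 then c else find N p q s h (d - 1))
      else if kind p q c = 2 ∧ stk N p q c = s then find N p q s h (d + 1)
      else find N p q s h d

theorem find_mem (N p q s : ℕ) (h : List ℕ) (d : ℕ) :
    find N p q s h d = 0 ∨ find N p q s h d ∈ h := by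
  induction h generalizing d with
  | nil => exact .inl rfl
  | cons c h ih =>
    unfold find
    split_ifs
    · exact .inr List.mem_cons_self
    all_goals exact (ih _).imp_right (List.mem_cons_of_mem c)

theorem foldl_scanStep_of_lt {N p q s a : ℕ} (ha : a < N) (h : List ℕ) :
    h.foldl (scanStep N p q s) a = a := by
  induction h with
  | nil => rfl
  | cons c h ih => rw [List.foldl_cons, scanStep, if_pos ha, ih]

/-- An accumulator `N + d` means that the search is still on at depth `d`; a value below `N` is a
final answer. Digits below `N` keep the two cases apart. -/
theorem foldl_scanStep {N p q s : ℕ} (h : List ℕ) (hN : ∀ c ∈ h, c < N) (d : ℕ) :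
    (if h.foldl (scanStep N p q s) (N + d) < N then h.foldl (scanStep N p q s) (N + d) else 0) =
      find N p q s h d := by
  induction h generalizing d with
  | nil => simp [find]
  | cons c h ih =>
    have ih' := ih fun c hc => hN c (List.mem_cons_of_mem _ hc)
    have hc := hN c List.mem_cons_self
    rw [List.foldl_cons, find, scanStep, if_neg (by lia : ¬N + d < N)]
    by_cases h₁ : kind p q c = 1 ∧ stk N p q c = s
    · rw [if_pos h₁, if_pos h₁]
      by_cases h₂ : d = 0
      · rw [if_pos h₂, if_pos (by lia : N + d = N), foldl_scanStep_of_lt hc, if_pos hc]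
      · rw [if_neg h₂, if_neg (by lia : ¬N + d = N), Nat.add_sub_assoc (by lia)]
        exact ih' _
    · rw [if_neg h₁, if_neg h₁]
      by_cases h₂ : kind p q c = 2 ∧ stk N p q c = s
      · rw [if_pos h₂, if_pos h₂]
        exact ih' (d + 1)
      · rw [if_neg h₂, if_neg h₂]
        exact ih' d

theorem digit_ofDigits {N : ℕ} (hN : 2 ≤ N) (h : List ℕ) (hh : ∀ c ∈ h, c ≠ 0 ∧ c < N) (i : ℕ) :
    digit N (Nat.ofDigits N h) i = h.getD i 0 := by
  rw [digit, ← Nat.getD_digits _ _ hN, Nat.digits_ofDigits N (by lia) h (fun c hc => (hh c hc).2)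
    fun hne => (hh _ (List.getLast_mem hne)).1]

/-- Digits beyond the end of the history are `0`, whose kind is `0`, so scanning too far changes
nothing. Nonzero digits ensure that the list is recovered from its number. -/
theorem rec_scanStep {N p q s : ℕ} (hN : 2 ≤ N) (h₀ : kind p q 0 = 0) (h : List ℕ)
    (hh : ∀ c ∈ h, c ≠ 0 ∧ c < N) (a V : ℕ) :
    Nat.rec a (fun i a => scanStep N p q s a (digit N (Nat.ofDigits N h) i)) V =
      (h.take V).foldl (scanStep N p q s) a := by
  induction V with
  | zero => simp
  | succ V ih =>
    refine (congrArg (fun a => scanStep N p q s a (digit N (Nat.ofDigits N h) V)) ih).trans ?_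
    simp only [digit_ofDigits hN h hh]
    rcases Nat.lt_or_ge V h.length with hV | hV
    · rw [List.take_add_one, List.foldl_append, List.getD_eq_getElem?_getD,
        List.getElem?_eq_getElem hV]
      rfl
    · rw [List.take_of_length_le hV, List.take_of_length_le (by lia)]
      simp [List.getElem?_eq_none hV, scanStep, h₀]

theorem scan_ofDigits {N p q : ℕ} (hN : 2 ≤ N) (h₀ : kind p q 0 = 0) (s : ℕ) (h : List ℕ)
    (hh : ∀ c ∈ h, c ≠ 0 ∧ c < N) {V : ℕ} (hV : h.length ≤ V) :
    scan N p q s V (Nat.ofDigits N h) = find N p q s h 0 := by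
  unfold scan
  simp only [rec_scanStep hN h₀ h hh, List.take_of_length_le hV]
  exact foldl_scanStep h (fun c hc => (hh c hc).2) 0

variable {M : TM2ComputableAux (Option Bool) Bool} (τ : Table M)

namespace Table

/-- A history made of codes of control states. -/
def IsHist (h : List ℕ) : Prop := ∀ n ∈ h, ∃ c : Ctl M, c.Good ∧ n = τ.code c

variable {τ}

theorem IsHist.cons {h : List ℕ} (hh : τ.IsHist h) {c : Ctl M} (hc : c.Good) :
    τ.IsHist (τ.code c :: h) := by
  intro n hn
  rcases List.mem_cons.1 hn with rfl | hn
  · exact ⟨c, hc, rfl⟩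
  · exact hh n hn

theorem IsHist.digits {h : List ℕ} (hh : τ.IsHist h) : ∀ n ∈ h, n ≠ 0 ∧ n < τ.N := by
  intro n hn
  obtain ⟨c, hc, rfl⟩ := hh n hn
  exact ⟨τ.code_ne_zero c hc, τ.code_lt c hc⟩

variable (τ)

/-- The control state that pushed the symbol at a given depth of a stack. -/
noncomputable def origin (k : M.tm.K) (h : List ℕ) (d : ℕ) : Option (Ctl M) :=
  let m := find τ.N τ.p τ.q (τ.ix k) h d
  if m = 0 then none else some (τ.dec m)

/-- One step of the history machine, on lists. -/
noncomputable def listStep (z : Ctl M × List ℕ) : Ctl M × List ℕ :=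
  (z.1.next (τ.origin z.1.stack z.2 0), τ.code z.1 :: z.2)

/-- The new history has `h.length + 2` digits, so under `hV` the cut-off is inactive. -/
theorem histStep_ofDigits {c : Ctl M} {h : List ℕ} (hc : c.Good) (hh : τ.IsHist h) {V : ℕ}
    (hV : τ.N ^ (h.length + 2) ≤ V) :
    histStep τ.N τ.p τ.q V (Nat.ofDigits τ.N (τ.code c :: h)) =
      Nat.ofDigits τ.N (τ.code (τ.listStep (c, h)).1 :: (τ.listStep (c, h)).2) := by
  have hcN := τ.code_lt c hc
  have hN := τ.two_le
  have e₁ : Nat.ofDigits τ.N (τ.code c :: h) % τ.N = τ.code c := by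
    rw [Nat.ofDigits_cons, Nat.add_mul_mod_self_left, Nat.mod_eq_of_lt hcN]
  have e₂ : Nat.ofDigits τ.N (τ.code c :: h) / τ.N = Nat.ofDigits τ.N h := by
    rw [Nat.ofDigits_cons, Nat.add_mul_div_left _ _ (by lia), Nat.div_eq_of_lt hcN, zero_add]
  have hlen : h.length ≤ V := by
    refine le_trans ?_ ((Nat.pow_le_pow_left hN _).trans hV)
    exact (Nat.lt_two_pow_self (n := h.length + 2)).le.trans' (by lia)
  have hm : find τ.N τ.p τ.q (τ.ix c.stack) h 0 < τ.N := by
    rcases find_mem τ.N τ.p τ.q (τ.ix c.stack) h 0 with h' | h'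
    · lia
    · exact (hh.digits _ h').2
  have hlt : Nat.ofDigits τ.N (τ.code (τ.listStep (c, h)).1 :: (τ.listStep (c, h)).2) <
      τ.N ^ (h.length + 2) :=
    Nat.ofDigits_lt_base_pow_length hN fun n hn =>
      (((hh.cons hc).cons (hc.next (τ.origin c.stack h 0))).digits n hn).2
  rw [histStep, e₁, e₂, τ.stk_eq _ hcN, τ.dec_code c hc,
    scan_ofDigits hN τ.kind_zero _ h hh.digits hlen, τ.nxt_eq _ hcN _ hm, τ.dec_code c hc]
  rw [Nat.ofDigits_cons] at hlt ⊢
  exact min_eq_right (hlt.le.trans hV)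

theorem listStep_iterate {c : Ctl M} {h : List ℕ} (hc : c.Good) (hh : τ.IsHist h) (t : ℕ) :
    (τ.listStep^[t] (c, h)).1.Good ∧ τ.IsHist (τ.listStep^[t] (c, h)).2 ∧
      (τ.listStep^[t] (c, h)).2.length = h.length + t := by
  induction t with
  | zero => exact ⟨hc, hh, rfl⟩
  | succ t ih =>
    rw [iterate_succ_apply']
    exact ⟨ih.1.next _, ih.2.1.cons ih.1, by
      rw [listStep, List.length_cons, ih.2.2]; lia⟩

theorem histRun_ofDigits {c : Ctl M} {h : List ℕ} (hc : c.Good) (hh : τ.IsHist h) {V : ℕ} (t : ℕ)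
    (hV : τ.N ^ (h.length + t + 1) ≤ V) :
    histRun τ.N τ.p τ.q V t (Nat.ofDigits τ.N (τ.code c :: h)) =
      Nat.ofDigits τ.N (τ.code (τ.listStep^[t] (c, h)).1 :: (τ.listStep^[t] (c, h)).2) := by
  induction t with
  | zero => rfl
  | succ t ih =>
    have hN := τ.two_le
    obtain ⟨h₁, h₂, h₃⟩ := τ.listStep_iterate hc hh t
    rw [iterate_succ_apply', ← τ.histStep_ofDigits h₁ h₂ (V := V) (by
      rw [h₃]; exact hV), ← ih ((Nat.pow_le_pow_right (by lia) (by lia)).trans hV)]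
    rfl

/-! ### Stacks -/

/-- The stacks have the contents that the history tells. -/
def StkRel (h : List ℕ) (S : ∀ k, List (M.tm.Γ k)) : Prop :=
  ∀ k d, (S k)[d]? = (τ.origin k h d).bind fun c => c.sym k

variable {τ} {h : List ℕ} {S : ∀ k, List (M.tm.Γ k)}

theorem stkRel_nil : τ.StkRel [] fun _ => [] := fun k d => by simp [origin, find]

theorem StkRel.head (hS : τ.StkRel h S) (k : M.tm.K) :
    (τ.origin k h 0).bind (fun c => c.sym k) = (S k).head? := by
  rw [← hS k 0, List.head?_eq_getElem?]

/-- After a push, depth `0` is answered by the new state, and depth `d + 1` is depth `d` in the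
older history; other stacks do not notice. -/
theorem StkRel.push (hS : τ.StkRel h S) {c : Ctl M} (hc : c.Good) (hk : c.kind = 1)
    {a : M.tm.Γ c.stack} (ha : c.sym c.stack = some a) :
    τ.StkRel (τ.code c :: h) (update S c.stack (a :: S c.stack)) := by
  intro k d
  have h₁ : kind τ.p τ.q (τ.code c) = 1 := by
    rw [τ.kind_eq _ (τ.code_lt c hc), τ.dec_code c hc, hk]
  have h₂ : stk τ.N τ.p τ.q (τ.code c) = τ.ix c.stack := by
    rw [τ.stk_eq _ (τ.code_lt c hc), τ.dec_code c hc]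
  rw [origin, find, h₁, h₂]
  by_cases hk' : k = c.stack
  · subst hk'
    rw [update_self]
    cases d with
    | zero => simp [τ.code_ne_zero c hc, τ.dec_code c hc, ha]
    | succ d => simpa [origin] using hS c.stack d
  · have : τ.ix c.stack ≠ τ.ix k := fun h => hk' (τ.ix_inj h).symm
    rw [update_of_ne hk']
    simpa [origin, this] using hS k d

/-- After a pop, depth `d` is depth `d + 1` in the older history. This also covers popping an empty
stack, where both sides are absent. -/
theorem StkRel.pop (hS : τ.StkRel h S) {c : Ctl M} (hc : c.Good) (hk : c.kind = 2) :
    τ.StkRel (τ.code c :: h) (update S c.stack (S c.stack).tail) := by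
  intro k d
  have h₁ : kind τ.p τ.q (τ.code c) = 2 := by
    rw [τ.kind_eq _ (τ.code_lt c hc), τ.dec_code c hc, hk]
  have h₂ : stk τ.N τ.p τ.q (τ.code c) = τ.ix c.stack := by
    rw [τ.stk_eq _ (τ.code_lt c hc), τ.dec_code c hc]
  rw [origin, find, h₁, h₂]
  by_cases hk' : k = c.stack
  · subst hk'
    rw [update_self, List.getElem?_tail]
    simpa [origin] using hS c.stack (d + 1)
  · have : τ.ix c.stack ≠ τ.ix k := fun h => hk' (τ.ix_inj h).symm
    rw [update_of_ne hk']
    simpa [origin, this] using hS k d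

theorem StkRel.skip (hS : τ.StkRel h S) {c : Ctl M} (hc : c.Good) (hk : c.kind = 0) :
    τ.StkRel (τ.code c :: h) S := by
  intro k d
  have h₁ : kind τ.p τ.q (τ.code c) = 0 := by
    rw [τ.kind_eq _ (τ.code_lt c hc), τ.dec_code c hc, hk]
  rw [origin, find, h₁]
  simpa [origin] using hS k d

/-! ### Simulation -/

/-- The control state at the beginning of a step of the machine. -/
def _root_.TimeClasses.HistSim.ctl (l : Option M.tm.Λ) (v : M.tm.σ) : Ctl M :=
  match l with
  | some l => .run (M.tm.m l) v
  | none => .out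

/-- The number of instructions in a statement. -/
def _root_.TimeClasses.HistSim.depth : TM2.Stmt M.tm.Γ M.tm.Λ M.tm.σ → ℕ
  | .push _ _ q => depth q + 1
  | .peek _ _ q => depth q + 1
  | .pop _ _ q => depth q + 1
  | .load _ q => depth q + 1
  | .branch _ q₁ q₂ => max (depth q₁) (depth q₂) + 1
  | .goto _ => 1
  | .halt => 1

/-- One step of the stack machine runs a whole statement, while the history machine performs one
instruction at a time, hence at most `depth q` steps. Peeks and pops see the right symbol because
`StkRel` at depth `0` identifies the top. -/
theorem simulate_stmt (q : TM2.Stmt M.tm.Γ M.tm.Λ M.tm.σ) (v : M.tm.σ) (h : List ℕ)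
    (S : ∀ k, List (M.tm.Γ k)) (hq : (Ctl.run q v).Good) (hS : τ.StkRel h S) :
    ∃ i ≤ depth q, ∃ h', τ.listStep^[i] (.run q v, h) =
      (ctl (TM2.stepAux q v S).l (TM2.stepAux q v S).var, h') ∧
        τ.StkRel h' (TM2.stepAux q v S).stk := by
  have step : ∀ {q q' : TM2.Stmt M.tm.Γ M.tm.Λ M.tm.σ} {v v' : M.tm.σ} {h h' : List ℕ}
      {S S' : ∀ k, List (M.tm.Γ k)} {n : ℕ},
      τ.listStep (.run q v, h) = (.run q' v', h') →
      TM2.stepAux q v S = TM2.stepAux q' v' S' →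
      (∃ i ≤ n, ∃ h'', τ.listStep^[i] (.run q' v', h') =
        (ctl (TM2.stepAux q' v' S').l (TM2.stepAux q' v' S').var, h'') ∧
          τ.StkRel h'' (TM2.stepAux q' v' S').stk) →
      ∃ i ≤ n + 1, ∃ h'', τ.listStep^[i] (.run q v, h) =
        (ctl (TM2.stepAux q v S).l (TM2.stepAux q v S).var, h'') ∧
          τ.StkRel h'' (TM2.stepAux q v S).stk := by
    intro q q' v v' h h' S S' n h₁ h₂ ⟨i, hi, h'', h₃, h₄⟩
    rw [h₂]
    exact ⟨i + 1, by lia, h'', by rw [iterate_succ_apply, h₁, h₃], h₄⟩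
  have good : ∀ (o : Option (Ctl M)) {q q' : TM2.Stmt M.tm.Γ M.tm.Λ M.tm.σ} {v v' : M.tm.σ},
      (Ctl.run q v).Good → (Ctl.run q v).next o = .run q' v' → (Ctl.run q' v').Good :=
    fun o _ _ _ _ h₁ h₂ => h₂ ▸ h₁.next o
  induction q generalizing v h S with
  | push k f q ih =>
    exact step (h' := τ.code (.run (.push k f q) v) :: h) rfl rfl
      (ih v _ _ (good none hq rfl) (hS.push hq rfl (a := f v) (by simp [Ctl.sym, Ctl.stack])))
  | peek k f q ih =>
    refine step (h' := τ.code (.run (.peek k f q) v) :: h) (v' := f v (S k).head?) ?_ rfl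
      (ih _ _ _ (good (τ.origin k h 0) hq (by rw [← hS.head k]; rfl)) (hS.skip hq rfl))
    rw [← hS.head k]; rfl
  | pop k f q ih =>
    refine step (h' := τ.code (.run (.pop k f q) v) :: h) (v' := f v (S k).head?) ?_ rfl
      (ih _ _ _ (good (τ.origin k h 0) hq (by rw [← hS.head k]; rfl)) (hS.pop hq rfl))
    rw [← hS.head k]; rfl
  | load f q ih =>
    exact step (h' := τ.code (.run (.load f q) v) :: h) rfl rfl
      (ih _ _ _ (good none hq rfl) (hS.skip hq rfl))
  | branch f q₁ q₂ ih₁ ih₂ =>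
    cases hf : f v with
    | true =>
      obtain ⟨i, hi, h'⟩ := step (h := h) (S := S) (v := v) (q := .branch f q₁ q₂) (v' := v)
        (q' := q₁) (h' := τ.code (.run (.branch f q₁ q₂) v) :: h)
        (by simp [listStep, Ctl.next, hf]) (by simp [hf])
        (ih₁ v _ S (good none hq (by simp [Ctl.next, hf])) (hS.skip hq rfl))
      exact ⟨i, hi.trans (Nat.add_le_add_right (le_max_left _ _) 1), h'⟩
    | false =>
      obtain ⟨i, hi, h'⟩ := step (h := h) (S := S) (v := v) (q := .branch f q₁ q₂) (v' := v)
        (q' := q₂) (h' := τ.code (.run (.branch f q₁ q₂) v) :: h)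
        (by simp [listStep, Ctl.next, hf]) (by simp [hf])
        (ih₂ v _ S (good none hq (by simp [Ctl.next, hf])) (hS.skip hq rfl))
      exact ⟨i, hi.trans (Nat.add_le_add_right (le_max_right _ _) 1), h'⟩
  | goto f => exact ⟨1, le_rfl, _, rfl, hS.skip hq rfl⟩
  | halt => exact ⟨1, le_rfl, _, rfl, hS.skip hq rfl⟩

theorem simulate_run {B : ℕ} (hB : ∀ l, depth (M.tm.m l) ≤ B) (n : ℕ)
    (c c' : TM2.Cfg M.tm.Γ M.tm.Λ M.tm.σ) (h : List ℕ)
    (hc : Cmd.iter (TM2.step M.tm.m) n (some c) = some c') (hS : τ.StkRel h c.stk) :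
    ∃ i ≤ B * n, ∃ h', τ.listStep^[i] (ctl c.l c.var, h) = (ctl c'.l c'.var, h') ∧
      τ.StkRel h' c'.stk := by
  induction n generalizing c h with
  | zero =>
    obtain rfl : c = c' := Option.some.inj hc
    exact ⟨0, le_rfl, h, rfl, hS⟩
  | succ n ih =>
    unfold Cmd.iter at hc ih
    rw [iterate_succ_apply] at hc
    obtain ⟨l, v, S⟩ := c
    cases l with
    | none =>
      have : ∀ n, (flip bind (TM2.step M.tm.m))^[n] none = none := fun n =>
        iterate_fixed rfl n
      exact absurd ((this n).symm.trans hc) (by simp)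
    | some l =>
      obtain ⟨i, hi, h', e, hS'⟩ := simulate_stmt (M.tm.m l) v h S ⟨l, TM2.stmts₁_self⟩ hS
      obtain ⟨j, hj, h'', e', hS''⟩ := ih _ h' hc hS'
      have hBl := hB l
      refine ⟨j + i, by rw [Nat.mul_succ]; lia, h'', ?_, hS''⟩
      rw [iterate_add_apply]
      exact (congrArg _ e).trans e'

end Table

end HistSim

end TimeClasses

/-! ### Input, output and descriptions -/

namespace TimeClasses

open Turing Function

namespace HistSim

theorem natRec_shift {α : Type} (g : ℕ → α → α) (a : α) (n : ℕ) :
    (Nat.rec a g (n + 1) : α) = Nat.rec (g 0 a) (fun i => g (i + 1)) n := by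
  induction n with
  | zero => rfl
  | succ n ih => exact congrArg (g (n + 1)) ih

/-- The loop takes bits from the least significant end, that is, from the last letter of `x`, so the
first letter is pushed last and ends on top. Hence the induction from the right of `x`. -/
theorem rec_input {N : ℕ} (hN : 2 < N) (x : List Bool) (g : List ℕ) (hg : ∀ d ∈ g, d < N) {V : ℕ}
    (hV : N ^ (x.length + g.length) ≤ V) :
    Nat.rec (Nat.ofDigits N g) (fun i a => min V (N * a + (1 + natOf x / 2 ^ i % 2))) x.length =
      Nat.ofDigits N (x.map (fun b => 1 + b.toNat) ++ g) := by
  induction x using List.reverseRecOn generalizing g with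
  | nil => rfl
  | append_singleton x b ih =>
    rw [List.length_append, List.length_singleton] at *
    have hg' : ∀ d ∈ (1 + b.toNat) :: g, d < N := by
      intro d hd
      rcases List.mem_cons.1 hd with rfl | hd
      · cases b <;> simp <;> lia
      · exact hg d hd
    have hlt := Nat.ofDigits_lt_base_pow_length (by lia : 1 < N) hg'
    have e₀ : min V (N * Nat.ofDigits N g + (1 + natOf (x ++ [b]) / 2 ^ 0 % 2)) =
        Nat.ofDigits N ((1 + b.toNat) :: g) := by
      have : natOf (x ++ [b]) / 2 ^ 0 % 2 = b.toNat := by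
        rw [natOf_append]
        cases b <;> simp
      rw [this]
      rw [Nat.ofDigits_cons, List.length_cons] at *
      have := Nat.pow_le_pow_right (by lia : 0 < N)
        (by lia : g.length + 1 ≤ x.length + 1 + g.length)
      lia
    have e₁ : ∀ i, natOf (x ++ [b]) / 2 ^ (i + 1) = natOf x / 2 ^ i := by
      intro i
      rw [natOf_append, pow_succ', ← Nat.div_div_eq_div_mul]
      congr 1
      cases b <;> simp; lia
    refine (natRec_shift (fun i a => min V (N * a + (1 + natOf (x ++ [b]) / 2 ^ i % 2))) _
      x.length).trans ?_
    simp only [e₁]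
    rw [e₀, ih _ hg' (by rw [List.length_cons]; convert hV using 2; lia)]
    simp

variable {M : TM2ComputableAux (Option Bool) Bool} (τ : Table M)

namespace Table

theorem stkRel_input (w : List (Option Bool)) :
    τ.StkRel (w.map fun a => τ.code (.inp a))
      (update (fun _ => []) M.tm.k₀ (w.map M.inputAlphabet.invFun)) := by
  induction w with
  | nil => simpa using stkRel_nil
  | cons a w ih =>
    have := ih.push (c := .inp a) trivial rfl (a := M.inputAlphabet.symm a) (by
      simp [Ctl.sym, Ctl.stack])
    simpa [Ctl.stack] using this

theorem isHist_input (w : List (Option Bool)) : τ.IsHist (w.map fun a => τ.code (.inp a)) := by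
  intro n hn
  obtain ⟨a, -, rfl⟩ := List.mem_map.1 hn
  exact ⟨.inp a, trivial, rfl⟩

theorem initList_eq (s : List (M.tm.Γ M.tm.k₀)) :
    initList M.tm s = (⟨some M.tm.main, M.tm.initialState, update (fun _ => []) M.tm.k₀ s⟩ :
      TM2.Cfg M.tm.Γ M.tm.Λ M.tm.σ) := by
  unfold initList
  congr 1
  funext k
  by_cases h : k = M.tm.k₀
  · subst h; simp
  · simp [h]

theorem listStep_iterate_halted {c : Ctl M} (hc : ∀ o, c.next o = c) (h : List ℕ) (t : ℕ) :
    (τ.listStep^[t] (c, h)).1 = c := by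
  induction t generalizing h with
  | zero => rfl
  | succ t ih => rw [iterate_succ_apply, listStep, hc]; exact ih _

/-- The two extra steps are those of `start` and `out`. Afterwards `acc` and `rej` are absorbing, so
the answer is the same at every later time. -/
theorem exists_iterate_eq {B : ℕ} (hB : ∀ l, depth (M.tm.m l) ≤ B) {w : List (Option Bool)} {b : Bool}
    {m t : ℕ} (hm : Nonempty (TM2OutputsInTime M.tm (w.map M.inputAlphabet.invFun)
      (some ([b].map M.outputAlphabet.invFun)) m)) (ht : B * m + 2 ≤ t) :
    (τ.listStep^[t] (.start, w.map fun a => τ.code (.inp a))).1 = if b then .acc else .rej := by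
  obtain ⟨⟨⟨n, hn⟩, hnm⟩⟩ := hm
  set h := w.map fun a => τ.code (.inp a)
  have hS := (τ.stkRel_input w).skip (c := .start) trivial rfl
  have e₀ := initList_eq (w.map M.inputAlphabet.invFun)
  obtain ⟨i, hi, h', e, hS'⟩ := simulate_run (τ := τ) hB n
    (initList M.tm (w.map M.inputAlphabet.invFun))
    (haltList M.tm ([b].map M.outputAlphabet.invFun)) (τ.code .start :: h) hn (by rw [e₀]; exact hS)
  have e₁ : τ.listStep (.start, h) =
      (ctl (initList M.tm (w.map M.inputAlphabet.invFun)).l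
        (initList M.tm (w.map M.inputAlphabet.invFun)).var, τ.code .start :: h) := rfl
  have hB' := Nat.mul_le_mul (le_refl B) hnm
  obtain ⟨r, rfl⟩ : ∃ r, t = r + (1 + (i + 1)) := ⟨t - (1 + (i + 1)), by
    change n ≤ m at hnm
    lia⟩
  have hout : ((τ.origin M.tm.k₁ h' 0).bind fun c => c.sym M.tm.k₁) =
      some (M.outputAlphabet.symm b) := by
    rw [hS'.head]
    simp [haltList]
  have e₂ : τ.listStep^[1 + (i + 1)] (.start, h) =
      (if b then .acc else .rej, τ.code .out :: h') := by
    rw [iterate_add_apply, iterate_succ_apply τ.listStep i, e₁, e]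
    change (Ctl.next .out (τ.origin M.tm.k₁ h' 0), _) = _
    congr 1
    cases b with
    | true => exact if_pos hout
    | false => exact if_neg fun h => by simpa using hout.symm.trans h
  rw [iterate_add_apply, e₂]
  exact τ.listStep_iterate_halted (by cases b <;> exact fun _ => rfl) _ _

end Table

/-- Every machine with advice is simulated by the history machine; the description of the machine
and the advice is not much longer than the advice. -/
theorem exists_description (M : TM2ComputableAux (Option Bool) Bool) :
    ∃ N p q B : ℕ, ∀ a : List Bool, ∃ G < N ^ (a.length + 1), ∀ (x : List Bool) (b : Bool)
      (m t V : ℕ), Nonempty (TM2OutputsInTime M.tm ((withAdvice x a).map M.inputAlphabet.invFun)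
        (some ([b].map M.outputAlphabet.invFun)) m) → B * m + 2 ≤ t →
      N ^ (x.length + a.length + t + 3) ≤ V →
      (histRun N p q V t (histInit N V x.length G (natOf x)) % N = 5 ↔ b = true) := by
  obtain ⟨τ⟩ := exists_table M
  have := M.tm.ΛFin
  obtain ⟨B, hB⟩ : ∃ B, ∀ l, depth (M.tm.m l) ≤ B :=
    ⟨Finset.univ.sup fun l => depth (M.tm.m l), fun l =>
      Finset.le_sup (f := fun l => depth (M.tm.m l)) (Finset.mem_univ l)⟩
  have hN : 5 < τ.N := τ.code_acc ▸ τ.code_lt .acc trivial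
  refine ⟨τ.N, τ.p, τ.q, B, fun a => ?_⟩
  set g := (none :: a.map some).map fun a => τ.code (.inp a) with hg
  have hgN : ∀ d ∈ g, d < τ.N := fun d hd => ((τ.isHist_input _).digits d hd).2
  have hgl : g.length = a.length + 1 := by simp [hg]
  refine ⟨Nat.ofDigits τ.N g, hgl ▸ Nat.ofDigits_lt_base_pow_length (by lia) hgN,
    fun x b m t V hm ht hV => ?_⟩
  set h := (withAdvice x a).map fun a => τ.code (.inp a) with hh
  have hhl : h.length = x.length + a.length + 1 := by simp [hh, withAdvice]; lia
  have pw : ∀ i ≤ x.length + a.length + t + 3, τ.N ^ i ≤ V := fun i hi =>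
    (Nat.pow_le_pow_right (by lia) hi).trans hV
  have e₁ : histInit τ.N V x.length (Nat.ofDigits τ.N g) (natOf x) =
      Nat.ofDigits τ.N (τ.code .start :: h) := by
    have : x.map (fun b => 1 + b.toNat) ++ g = h := by
      simp [hh, hg, withAdvice, τ.code_bit]
    rw [histInit, rec_input (by lia) x g hgN (pw _ (by lia)), this]
    have hlt : Nat.ofDigits τ.N (τ.code .start :: h) < τ.N ^ (h.length + 1) :=
      Nat.ofDigits_lt_base_pow_length (by lia) fun n hn =>
        ((Table.IsHist.cons (τ.isHist_input _) (c := .start) trivial).digits n hn).2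
    rw [Nat.ofDigits_cons, τ.code_start] at *
    exact min_eq_right (hlt.le.trans (pw _ (by lia)))
  have hgood := (τ.listStep_iterate (c := .start) trivial (τ.isHist_input (withAdvice x a)) t).1
  rw [e₁, τ.histRun_ofDigits (c := .start) trivial (τ.isHist_input _) t (pw _ (by lia)),
    Nat.ofDigits_cons, Nat.add_mul_mod_self_left, Nat.mod_eq_of_lt (τ.code_lt _ hgood),
    τ.exists_iterate_eq hB hm ht]
  cases b with
  | true => simpa using τ.code_acc
  | false =>
    simp only [Bool.false_eq_true, if_false, iff_false]
    intro h5
    -- If `rej` had the code `5` of `acc`, decoding would identify the two.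
    have h₁ := τ.dec_code .rej trivial
    rw [h5, ← τ.code_acc, τ.dec_code .acc trivial] at h₁
    cases h₁

end HistSim

end TimeClasses

namespace TimeClasses

open Turing Function

/-! ### Diagonalisation -/

/-- Otherwise each of the `2^(2^n)` tables agrees with one of fewer descriptions, so two tables
share a description. They then have the same bits below `2^n`, and no others. -/
theorem exists_hard (V t n : ℕ) : ∃ F < 2 ^ 2 ^ n, Hard V t (2 ^ n) (2 ^ 2 ^ n) n F := by
  by_contra hcon
  have h : ∀ F ∈ Finset.range (2 ^ 2 ^ n), ∃ D ∈ Finset.range (2 ^ 2 ^ n - 1),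
      ∀ Y < 2 ^ n, (F / 2 ^ Y % 2 = 1 ↔ Accepts V t n D Y) := by
    intro F hF
    by_contra hF'
    refine hcon ⟨F, Finset.mem_range.1 hF, fun D hD => ?_⟩
    by_contra hD'
    refine hF' ⟨D, Finset.mem_range.2 hD, fun Y hY => ?_⟩
    by_contra hY'
    exact hD' ⟨Y, hY, hY'⟩
  choose! D hD₁ hD₂ using h
  obtain ⟨F, hF, F', hF', hne, heq⟩ := Finset.exists_ne_map_eq_of_card_lt_of_maps_to
    (by simp only [Finset.card_range]; have : 0 < 2 ^ 2 ^ n := by positivity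
        lia) hD₁
  refine hne (Nat.eq_of_testBit_eq fun Y => ?_)
  rcases Nat.lt_or_ge Y (2 ^ n) with hY | hY
  · have h₁ := hD₂ F hF Y hY
    have h₂ := hD₂ F' hF' Y hY
    rw [← heq] at h₂
    rw [Nat.testBit_eq_decide_div_mod_eq, Nat.testBit_eq_decide_div_mod_eq]
    exact decide_eq_decide.2 (h₁.trans h₂.symm)
  · rw [Nat.testBit_lt_two_pow ((Finset.mem_range.1 hF).trans_le (Nat.pow_le_pow_right (by lia) hY)),
      Nat.testBit_lt_two_pow ((Finset.mem_range.1 hF').trans_le (Nat.pow_le_pow_right (by lia) hY))]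

/-- The diagonal predicate is different from what any description accepts. -/
theorem exists_diag_ne (V t n D : ℕ) (hD : D < 2 ^ 2 ^ n - 1) :
    ∃ Y < 2 ^ n, ¬(Diag V t (2 ^ n) (2 ^ 2 ^ n) n Y ↔ Accepts V t n D Y) := by
  classical
  have hex := exists_hard V t n
  obtain ⟨hF₁, hF₂⟩ := Nat.find_spec hex
  have hmin : ∀ F' < Nat.find hex, ¬Hard V t (2 ^ n) (2 ^ 2 ^ n) n F' := fun F' hF' h =>
    Nat.find_min hex hF' ⟨hF'.trans hF₁, h⟩
  obtain ⟨Y, hY, hne⟩ := hF₂ D hD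
  refine ⟨Y, hY, fun h => hne ?_⟩
  rw [← h]
  constructor
  · exact fun hb => ⟨_, hF₁, hF₂, hmin, hb⟩
  -- Any witness of `Diag` is hard with no smaller hard table, hence is the least one.
  · rintro ⟨F, -, hF, hF', hb⟩
    have : F = Nat.find hex := by
      rcases lt_trichotomy F (Nat.find hex) with hlt | heq | hgt
      · exact absurd hF (hmin F hlt)
      · exact heq
      · exact absurd hF₂ (hF' _ hgt)
    rwa [← this]

theorem exists_natOf_eq (n : ℕ) : ∀ Y < 2 ^ n, ∃ x : List Bool, x.length = n ∧ natOf x = Y := by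
  induction n with
  | zero => exact fun Y hY => ⟨[], rfl, by simp [natOf]; lia⟩
  | succ n ih =>
    intro Y hY
    obtain ⟨x, hx, hxY⟩ := ih (Y / 2) (by rw [pow_succ] at hY; lia)
    refine ⟨x ++ [decide (Y % 2 = 1)], by simp [hx], ?_⟩
    rw [natOf_append, hxY]
    rcases Nat.mod_two_eq_zero_or_one Y with h | h <;> simp [h] <;> lia

/-! ### Growth rates -/

open Filter Topology

/-- In both cases the advice length plus `4` is at most `A * r ^ n * 2 ^ n` with `r < 1`, and `n * r
^ n` tends to `0`. The sign of `ε` matters because for `ε ≤ 0` the exponent `c` may exceed `1`. -/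
theorem eventually_mul_advice_le (c ε : ℝ) (h : c + ε < 1) :
    ∀ᶠ n : ℕ in atTop, n * (⌊ε * (2 : ℝ) ^ (c * (n : ℝ))⌋₊ + 4) ≤ 2 ^ n := by
  obtain ⟨r, A, hr0, hr1, hA, hs⟩ : ∃ r A : ℝ, 0 < r ∧ r < 1 ∧ 0 < A ∧
      ∀ n : ℕ, (⌊ε * (2 : ℝ) ^ (c * (n : ℝ))⌋₊ : ℝ) + 4 ≤ A * (r ^ n * 2 ^ n) := by
    rcases le_or_gt ε 0 with hε | hε
    · refine ⟨1 / 2, 4, by norm_num, by norm_num, by norm_num, fun n => ?_⟩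
      rw [Nat.floor_of_nonpos (mul_nonpos_of_nonpos_of_nonneg hε (by positivity)), ← mul_pow]
      norm_num
    · have hc : max c 0 < 1 := max_lt (by linarith) one_pos
      -- Taking `max c 0` instead of `c` lets the same power absorb the constant `4` when `c` is
      -- negative.
      refine ⟨2 ^ (max c 0 - 1), ε + 4, by positivity,
        Real.rpow_lt_one_of_one_lt_of_neg one_lt_two (by linarith), by positivity, fun n => ?_⟩
      have e : ((2 : ℝ) ^ (max c 0 - 1)) ^ n * 2 ^ n = 2 ^ (max c 0 * n) := by
        rw [← Real.rpow_natCast, ← Real.rpow_mul (by norm_num), ← Real.rpow_natCast,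
          ← Real.rpow_add (by norm_num)]
        congr 1; ring
      rw [e]
      have h₁ : (2 : ℝ) ^ (c * n) ≤ 2 ^ (max c 0 * n) := Real.rpow_le_rpow_of_exponent_le
        one_le_two (mul_le_mul_of_nonneg_right (le_max_left _ _) (Nat.cast_nonneg n))
      have h₂ : (1 : ℝ) ≤ 2 ^ (max c 0 * n) := Real.one_le_rpow one_le_two (by positivity)
      have h₃ : (⌊ε * (2 : ℝ) ^ (c * (n : ℝ))⌋₊ : ℝ) ≤ ε * 2 ^ (c * n) :=
        Nat.floor_le (by positivity)
      nlinarith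
  have ht := tendsto_pow_const_mul_const_pow_of_abs_lt_one 1 (r := r) (by rwa [abs_of_pos hr0])
  filter_upwards [ht.eventually_le_const (u := 1 / A) (by positivity)] with n hn
  have h₁ := hs n
  rw [pow_one, le_div_iff₀ hA] at hn
  have : (n : ℝ) * (⌊ε * (2 : ℝ) ^ (c * (n : ℝ))⌋₊ + 4) ≤ 2 ^ n :=
    calc (n : ℝ) * (⌊ε * (2 : ℝ) ^ (c * (n : ℝ))⌋₊ + 4) ≤ n * (A * (r ^ n * 2 ^ n)) :=
          mul_le_mul_of_nonneg_left h₁ (Nat.cast_nonneg n)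
      _ = n * r ^ n * A * 2 ^ n := by ring
      _ ≤ 1 * 2 ^ n := mul_le_mul_of_nonneg_right hn (by positivity)
      _ = 2 ^ n := one_mul _
  exact_mod_cast this

theorem eventually_const_mul_le (k A : ℝ) (hk : 1 ≤ k) :
    ∀ᶠ n : ℕ in atTop, A * (2 : ℝ) ^ (k * (n : ℝ) ^ k) ≤ 2 ^ n ^ (⌈k⌉₊ + 1) := by
  set K := ⌈k⌉₊ with hK
  have hkK : k ≤ K := Nat.le_ceil k
  have hK1 : 1 ≤ K := by exact_mod_cast hk.trans hkK
  filter_upwards [eventually_ge_atTop (max ⌈A⌉₊ (K + 1))] with n hn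
  have hnA : A ≤ 2 ^ n := by
    have h₁ : ⌈A⌉₊ < 2 ^ n := ((le_max_left _ _).trans hn).trans_lt Nat.lt_two_pow_self
    exact (Nat.le_ceil A).trans (by exact_mod_cast h₁.le)
  have hnK : K + 1 ≤ n := (le_max_right _ _).trans hn
  have h₁ : k * (n : ℝ) ^ k ≤ ((K * n ^ K : ℕ) : ℝ) := by
    push_cast
    refine mul_le_mul hkK ?_ (by positivity) (by positivity)
    rw [← Real.rpow_natCast]
    exact Real.rpow_le_rpow_of_exponent_le (by exact_mod_cast (by lia : 1 ≤ n)) hkK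
  have h₂ : n + K * n ^ K ≤ n ^ (K + 1) := by
    have : n ≤ n ^ K := Nat.le_self_pow (by lia) n
    calc n + K * n ^ K ≤ n ^ K * (K + 1) := by lia
      _ ≤ n ^ K * n := Nat.mul_le_mul le_rfl hnK
      _ = _ := (pow_succ _ _).symm
  calc A * (2 : ℝ) ^ (k * (n : ℝ) ^ k) ≤ 2 ^ n * 2 ^ (K * n ^ K) := by
        refine mul_le_mul hnA ?_ (by positivity) (by positivity)
        rw [← Real.rpow_natCast]
        exact Real.rpow_le_rpow_of_exponent_le one_le_two h₁
    _ = 2 ^ (n + K * n ^ K) := (pow_add _ _ _).symm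
    _ ≤ _ := pow_le_pow_right₀ one_le_two h₂

end TimeClasses

/-! ### Choice of parameters and the contradiction -/

namespace TimeClasses

open Filter

/-- The constants `N, p, q` are three digits in base `n`, and `G` takes at most `s + 1` more because
`N < n`. So the description is below `n^(s+4)`, and `n < 2^n` gives strictness. -/
theorem description_lt {N p q G n s : ℕ} (hN : N < n) (hp : p < n) (hq : q < n)
    (hG : G < N ^ (s + 1)) (hs : n * (s + 4) ≤ 2 ^ n) :
    N + n * (p + n * (q + n * G)) < 2 ^ 2 ^ n - 1 := by
  have h₁ : G + 1 ≤ n ^ (s + 1) := hG.trans_le (Nat.pow_le_pow_left hN.le _)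
  have h₂ : n ^ (s + 4) < 2 ^ 2 ^ n :=
    calc n ^ (s + 4) < (2 ^ n) ^ (s + 4) := Nat.pow_lt_pow_left Nat.lt_two_pow_self (by lia)
      _ = 2 ^ (n * (s + 4)) := (pow_mul _ _ _).symm
      _ ≤ _ := Nat.pow_le_pow_right (by lia) hs
  have h₃ : q + n * G + 1 ≤ n * n ^ (s + 1) := by nlinarith
  have h₄ : p + n * (q + n * G) + 1 ≤ n * (n * n ^ (s + 1)) := by nlinarith
  have h₅ : N + n * (p + n * (q + n * G)) + 1 ≤ n * (n * (n * n ^ (s + 1))) := by nlinarith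
  have h₆ : n * (n * (n * n ^ (s + 1))) = n ^ (s + 4) := by ring
  lia

theorem accepts_description {N p q G n : ℕ} (hN : N < n) (hp : p < n) (hq : q < n) (V t Y : ℕ) :
    Accepts V t n (N + n * (p + n * (q + n * G))) Y ↔
      histRun N p q V t (histInit N V n G Y) % N = 5 := by
  have hn : 0 < n := by lia
  have d : ∀ a b, a < n → (a + n * b) / n = b := fun a b h => by
    rw [Nat.add_mul_div_left _ _ hn, Nat.div_eq_of_lt h, zero_add]
  have m : ∀ a b, a < n → (a + n * b) % n = a := fun a b h => by
    rw [Nat.add_mul_mod_self_left, Nat.mod_eq_of_lt h]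
  rw [Accepts, m _ _ hN, d _ _ hN, m _ _ hp, d _ _ hp, m _ _ hq, d _ _ hq]

/-- A history of `2^(n^j)` steps on input and advice must fit under the cut-off; one more power of
`n` in the exponent suffices. -/
theorem pow_le_cut {N n s j : ℕ} (hN : N < n) (hn : 3 ≤ n) (hj : 1 ≤ j) (hs : s ≤ 2 ^ n) :
    N ^ (n + s + 2 ^ n ^ j + 3) ≤ Cmd.cut (j + 1) n := by
  have h₁ : n ≤ n ^ j := Nat.le_self_pow (by lia) n
  have h₂ : 2 ^ n ≤ 2 ^ n ^ j := Nat.pow_le_pow_right (by lia) h₁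
  have h₃ : n < 2 ^ n := Nat.lt_two_pow_self
  have h₄ : 2 ^ n * (2 ^ 2 * 2 ^ n ^ j) ≤ 2 ^ n ^ (j + 1) := by
    rw [← pow_add, ← pow_add]
    refine Nat.pow_le_pow_right (by lia) ?_
    rw [pow_succ]
    nlinarith
  calc N ^ (n + s + 2 ^ n ^ j + 3) ≤ (2 ^ n) ^ (n + s + 2 ^ n ^ j + 3) :=
        Nat.pow_le_pow_left (by lia) _
    _ = 2 ^ (n * (n + s + 2 ^ n ^ j + 3)) := (pow_mul _ _ _).symm
    _ ≤ _ := Nat.pow_le_pow_right (by lia)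
      ((Nat.mul_le_mul h₃.le (by lia)).trans h₄)

theorem diagAt_iff {j n X : ℕ} (hn : 1 ≤ n) :
    DiagAt j (Cmd.cut (j + 1) n) n X ↔
      Diag (Cmd.cut (j + 1) n) (2 ^ n ^ j) (2 ^ n) (2 ^ 2 ^ n) n X := by
  have h₁ : n ^ j ≤ n ^ (j + 1) := Nat.pow_le_pow_right hn (by lia)
  have h₂ : n ≤ n ^ (j + 1) := Nat.le_self_pow (by lia) n
  have h₃ : ∀ {a b : ℕ}, a ≤ b → 2 ^ a ≤ 2 ^ b := Nat.pow_le_pow_right (by lia)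
  have lt : ∀ a, a < 2 ^ a := fun a => Nat.lt_two_pow_self
  rw [DiagAt, Cmd.cut, min_eq_right (h₃ (h₁.trans (lt _).le)),
    min_eq_right (h₃ (h₂.trans (lt _).le)), min_eq_right (h₃ (h₃ h₂))]

end TimeClasses

open TimeClasses Filter in
theorem mainTheorem11 (k c ε : ℝ) (hk : 1 ≤ k) (hcε : c + ε < 1) :
    ¬ TimeClasses.EEXP ⊆ TimeClasses.DTIMEWithAdvice
        (fun n => (2 : ℝ) ^ (k * (n : ℝ) ^ k)) (fun n => ⌊ε * (2 : ℝ) ^ (c * (n : ℝ))⌋₊) := by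
  intro hsub
  -- The language is fixed by `k` alone, before the machine and its advice are known.
  set j := ⌈k⌉₊ + 1 with hj
  obtain ⟨M, α, C, hα, hM⟩ := hsub (diagLanguage_mem_EEXP j (j + 1) (by lia))
  obtain ⟨N, p, q, B, hdesc⟩ := HistSim.exists_description M
  -- The factor `B * |C| + 2` covers the slowdown `B`, the constant of the `O`, whose sign is
  -- unrestricted, and the two extra simulation steps. The last condition makes `N, p, q` digits in
  -- base `n`.
  obtain ⟨n, hn₁, hn₂, hn₃⟩ := ((eventually_mul_advice_le c ε hcε).and
    ((eventually_const_mul_le k (B * |C| + 2) hk).and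
      (eventually_gt_atTop (N + p + q + 3)))).exists
  obtain ⟨G, hG, hsim⟩ := hdesc (α n)
  have hs : n * ((α n).length + 4) ≤ 2 ^ n :=
    (Nat.mul_le_mul le_rfl (Nat.add_le_add_right (hα n) 4)).trans hn₁
  obtain ⟨Y, hY, hne⟩ := exists_diag_ne (Cmd.cut (j + 1) n) (2 ^ n ^ j) n _
    (description_lt (by lia : N < n) (by lia : p < n) (by lia : q < n) hG hs)
  obtain ⟨x, hx, rfl⟩ := exists_natOf_eq n Y hY
  obtain ⟨b, hb, m, hm, hout⟩ := hM x
  rw [hx] at hout hm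
  refine hne ?_
  rw [accepts_description (by lia) (by lia) (by lia), ← diagAt_iff (by lia)]
  have ht : B * m + 2 ≤ 2 ^ n ^ j := by
    have h₁ : (1 : ℝ) ≤ 2 ^ (k * (n : ℝ) ^ k) := Real.one_le_rpow one_le_two (by positivity)
    have h₂ : (m : ℝ) ≤ |C| * 2 ^ (k * (n : ℝ) ^ k) :=
      hm.trans (mul_le_mul_of_nonneg_right (le_abs_self C) (by positivity))
    have h₃ : (B : ℝ) * m ≤ B * (|C| * 2 ^ (k * (n : ℝ) ^ k)) :=
      mul_le_mul_of_nonneg_left h₂ (Nat.cast_nonneg B)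
    have h₄ : (B : ℝ) * m + 2 ≤ 2 ^ n ^ j := by
      refine le_trans ?_ hn₂
      linarith
    exact_mod_cast h₄
  have hlen : (α n).length ≤ 2 ^ n := by
    refine le_trans ?_ hs
    nlinarith [Nat.zero_le (α n).length]
  have key := hsim x b m (2 ^ n ^ j) (Cmd.cut (j + 1) n) hout ht (by
    rw [hx]
    exact pow_le_cut (by lia) (by lia) (by lia) hlen)
  rw [hx] at key
  rw [key, hb]
  change _ ↔ DiagAt j (Cmd.cut (j + 1) x.length) x.length (natOf x)
  rw [hx]
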